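/- \textbf{Setting.} Let $\mathsf k$ be an infinite field, $R=\mathsf k\{x_1,x_2,x_3\}$ the power series ring with maximal ideal $\mathfrak m$, acting by contraction on the divided power ring $S=\mathsf k_{DP}[X_1,X_2,X_3]$; $S_{<e}$ (resp. $S_{\le e}$) is the space of elements of degree less than (at most) $e$, and $f_d$ the degree-$d$ component of $f$. For an Artinian Gorenstein (AG) quotient $A=R/I$ of socle degree $j$ with maximal ideal $\mathfrak m_A$, let $H(A)_i=\dim_{\mathsf k}\mathfrak m_A^i/\mathfrak m_A^{i+1}$, let $$C(b)_i=\frac{\mathfrak m_A^i\cap(0:\mathfrak m_A^{j+1-b-i})}{\mathfrak m_A^{i+1}\cap(0:\mathfrak m_A^{j+1-b-i})},\qquad Q(b)_i=C(b)_i/C(b+1)_i ,$$ and let $\mathcal D(A)=(H(0),H(1),\dots)$, $H(b)_i=\dim_{\mathsf k}Q(b)_i$, be the symmetric decomposition of $H(A)$. $\mathrm{Gor}(\mathcal D)$ is the set of AG quotients $A$ of $R$ of socle degree $j$ with Hilbert function $H$ and $\mathcal D(A)=\mathcal D$. Put $n_c=\sum_{b\le c}H(b)_1$. For a basis $X,Y,Z$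 of $S_1$, let $x,y,z$ be the dual basis of $R_1$, and let $\mathsf k\{x,y\}_{\ge2}$ be the set of power series in $x,y$ without terms of degree less than $2$. For $\varphi\in\mathsf k\{x,y\}_{\ge2}$ write $\varphi(F)=\varphi\circ F$ and $f_{ex}(\varphi,F)=Z\varphi(F)+Z^{[2]}\varphi^2(F)+Z^{[3]}\varphi^3(F)+\cdots$ (a finite sum). \textbf{Statement.} Let $H$ satisfy $H_1=3$, let $a\ge2$, and let $\mathcal D$ be a symmetric decomposition of $H$ with $n_{a-1}=2$ and $n_a=3$. Call $F\in S$ standard with respect to $X,Y,Z$ if $F_d\in\mathsf k_{DP}[X,Y]$ for each $d>j-a$. (1) Let $R/\mathrm{Ann} f\in\mathrm{Gor}(\mathcal D)$. Then there is a basis $X,Y,Z$ of $S_1$ such that $X,Y\in\mathfrak m^{j-a}\circ f$ and $Z\in(\mathfrak m^{j-a-1}\circ f)\setminus(\mathfrak m^{j-a}\circ f)$. For every such basis there are $f_{st}\in S$, standard with respect to $X,Y,Z$ and with $R/\mathrm{Ann} f_{st}\in\mathrm{Gor}(\mathcal D)$, and $\varphi\in\mathsf k\{x,y\}_{\ge2}$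 such that $$f=f_{st}+f_{ex}(\varphi,f_{st}),$$ where either $\varphi=0$ (so $f_{ex}=0$), or $\varphi(f_{st})$ has degree at least $j-a$. (2) Fix a basis $X,Y,Z$ of $S_1$ and an $f_{st}$, standard with respect to it, with $R/\mathrm{Ann} f_{st}\in\mathrm{Gor}(\mathcal D)$. For $\varphi\in\mathsf k\{x,y\}_{\ge2}$ put $f_\varphi=f_{st}+f_{ex}(\varphi,f_{st})$ and let $[\varphi]$ be the class of $\varphi(f_{st})$ modulo $S_{<j-a}$. Let $V\subset S/S_{<j-a}$ be the vector space of all these classes. Then: (a) $R/\mathrm{Ann} f_\varphi\in\mathrm{Gor}(\mathcal D)$ for every $\varphi$. (b) $V$ parametrizes the exotic terms (those of degree greater than $j-a$): $f_\varphi-f_\psi\in S_{\le j-a}$ if and only if $[\varphi]=[\psi]$. (c) The parameter is determined by the algebra through linear equations: $\mathfrak m^{j-a}(z-\psi)\subset\mathrm{Ann} f_\varphi$ if and only if $[\psi]=[\varphi]$. (d) The algebras with fixed $f_{st}$ form an affine space parametrized by $V$: for every linear map $\sigma:V\to\mathsf k\{x,y\}_{\ge2}$ choosing representatives ($[\sigma(v)]=v$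 for all $v\in V$), the family $A_\sigma(f_{st})=\{R/\mathrm{Ann} f_{\sigma(v)}\mid v\in V\}$ is contained in $\mathrm{Gor}(\mathcal D)$ and $v\mapsto R/\mathrm{Ann} f_{\sigma(v)}$ is a bijection from $V$ onto it. (e) $V$ is finite-dimensional, of dimension $$\dim A_\sigma(f_{st})=\dim_{\mathsf k}V=\sum_{b=0}^{a-1}\ \sum_{u=j-a}^{j-b-2}H(b)_u .$$ -/

import Mathlib

namespace GorensteinDual

/-! ### Hilbert function and symmetric decomposition of a local algebra with maximal ideal `𝔪` -/

section LocalAlgebra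

variable (k : Type*) [Field k] {A : Type*} [CommRing A] [Algebra k A]

/-- The graded piece `𝔪^i / 𝔪^(i+1)` of the associated graded algebra `A*`. -/
abbrev GrPiece (𝔪 : Ideal A) (i : ℕ) : Type _ :=
  ↥(𝔪 ^ i) ⧸ (𝔪 ^ (i + 1)).submoduleOf (𝔪 ^ i)

/-- The Hilbert function `H(A)_i = dim_k 𝔪^i / 𝔪^(i+1)`. -/
noncomputable def hilb (𝔪 : Ideal A) (i : ℕ) : ℕ :=
  Module.finrank k (GrPiece 𝔪 i)

/-- The Loewy ideal `(0 : 𝔪^e)`. -/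
def loewy (𝔪 : Ideal A) (e : ℕ) : Ideal A :=
  Submodule.annihilator (𝔪 ^ e)

/-- `C(a)_i = 𝔪^i ∩ (0 : 𝔪^(j+1-a-i)) / 𝔪^(i+1) ∩ (0 : 𝔪^(j+1-a-i))`, as the submodule of
`𝔪^i / 𝔪^(i+1)` given by the classes of the elements of `𝔪^i ∩ (0 : 𝔪^(j+1-a-i))`.
(If `j+1-a-i ≤ 0` then `𝔪^(j+1-a-i) = A`, and `C(a)_i = 0`.) -/
def loewyFiltration (𝔪 : Ideal A) (j a i : ℕ) : Submodule A (GrPiece 𝔪 i) :=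
  ((loewy 𝔪 (j + 1 - a - i)).submoduleOf (𝔪 ^ i)).map
    ((𝔪 ^ (i + 1)).submoduleOf (𝔪 ^ i)).mkQ

/-- The entry `H(a)_i = dim_k Q(a)_i` of the symmetric decomposition of `A`, where
`Q(a)_i = C(a)_i / C(a+1)_i` and `j` is the socle degree of `A`. -/
noncomputable def symDecomp (𝔪 : Ideal A) (j a i : ℕ) : ℕ :=
  Module.finrank k
    (↥(loewyFiltration 𝔪 j a i) ⧸
      (loewyFiltration 𝔪 j (a + 1) i).submoduleOf (loewyFiltration 𝔪 j a i))

end LocalAlgebra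

/-! ### The families `Gor(H)` and `Gor(D)` -/

section Families

variable (k : Type*) [Field k]

/-- The regular local ring `R = k{x₁, x₂, x₃}`. -/
abbrev PS : Type _ := MvPowerSeries (Fin 3) k

variable {k}

/-- The maximal ideal of `R / I` (for a proper ideal `I`). -/
noncomputable def maxQuot (I : Ideal (PS k)) : Ideal (PS k ⧸ I) :=
  (IsLocalRing.maximalIdeal (PS k)).map (Ideal.Quotient.mk I)

/-- `Gor(H)`: the ideals `I` of `R` such that `R / I` is Artinian Gorenstein (its socle `(0 : 𝔪)` is
one-dimensional), of socle degree `j` and Hilbert function `H`. -/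
def Gor (j : ℕ) (H : ℕ → ℕ) : Set (Ideal (PS k)) :=
  {I | IsArtinianRing (PS k ⧸ I) ∧
    Module.finrank k (loewy (maxQuot I) 1) = 1 ∧
    maxQuot I ^ j ≠ ⊥ ∧ maxQuot I ^ (j + 1) = ⊥ ∧
    ∀ i, hilb k (maxQuot I) i = H i}

/-- `Gor(D)`: the ideals in `Gor(H)` whose quotient has symmetric decomposition
`D = (H(0), H(1), …)`, where `D a i = H(a)_i`. -/
def GorD (j : ℕ) (H : ℕ → ℕ) (D : ℕ → ℕ → ℕ) : Set (Ideal (PS k)) :=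
  {I | I ∈ Gor j H ∧ ∀ a i, symDecomp k (maxQuot I) j a i = D a i}

end Families

/-! ### The divided power ring and the contraction action -/

section DividedPowers

variable (k : Type*) [Field k]

/-- The divided power ring `S = k_DP[X₁, X₂, X₃]`: `F m` is the coefficient of the divided power
monomial `X₁^[m 0] X₂^[m 1] X₃^[m 2]`. -/
abbrev DP : Type _ := (Fin 3 →₀ ℕ) →₀ k

variable {k}

/-- The multiplication of `S`: the bilinear map with
`X^[m] * X^[n] = ∏ i, ((m i + n i).choose (m i)) X^[m + n]`. -/
noncomputable def dpMul : DP k →ₗ[k] DP k →ₗ[k] DP k :=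
  Finsupp.linearCombination k fun m : Fin 3 →₀ ℕ =>
    Finsupp.linearCombination k fun n : Fin 3 →₀ ℕ =>
      Finsupp.single (m + n) ((∏ i, (m i + n i).choose (m i) : ℕ) : k)

/-- The degree of an element of `S` (zero for the zero element). -/
noncomputable def dpDeg (F : DP k) : ℕ := F.support.sup Finsupp.degree

/-- The homogeneous component of degree `d` of an element of `S`. -/
noncomputable def dpComp (d : ℕ) (F : DP k) : DP k := F.filter fun m => m.degree = d

variable (k) in
/-- The subspace `S_{<d}` of the elements of degree less than `d`. -/
noncomputable def dpLT (d : ℕ) : Submodule k (DP k) := Finsupp.supported k k {m | m.degree < d}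

/-- The contraction action `r ∘ F` of `R` on `S`: the bilinear map with
`x^n ∘ X^[m] = X^[m - n]` if `n ≤ m`, and `0` otherwise. -/
noncomputable def contract : PS k →ₗ[k] DP k →ₗ[k] DP k where
  toFun r := Finsupp.linearCombination k fun m : Fin 3 →₀ ℕ =>
    ∑ p ∈ Finset.HasAntidiagonal.antidiagonal m, Finsupp.single p.2 (MvPowerSeries.coeff p.1 r)
  map_add' r s := by
    ext m : 2
    simp [Finset.sum_add_distrib]
  map_smul' c r := by
    ext m : 2
    simp [Finset.smul_sum]

theorem contract_single (r : PS k) (m : Fin 3 →₀ ℕ) (c : k) :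
    contract r (Finsupp.single m c) =
      c • ∑ p ∈ Finset.HasAntidiagonal.antidiagonal m, Finsupp.single p.2 (MvPowerSeries.coeff p.1 r) := by
  simp [contract]

theorem contract_mul (r s : PS k) (F : DP k) :
    contract (r * s) F = contract r (contract s F) := by
  classical
  suffices h : contract (r * s) = (contract r).comp (contract s) by rw [h]; rfl
  ext m : 2
  simp only [LinearMap.comp_apply, Finsupp.lsingle_apply, contract_single, one_smul, map_sum,
    MvPowerSeries.coeff_mul, Finsupp.single_finsetSum, Finset.smul_sum, Finsupp.smul_single,
    smul_eq_mul]
  rw [Finset.sum_sigma', Finset.sum_sigma']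
  refine Finset.sum_nbij' (fun x => ⟨(x.2.2, x.2.1 + x.1.2), (x.2.1, x.1.2)⟩)
    (fun x => ⟨(x.2.1 + x.1.1, x.2.2), (x.2.1, x.1.1)⟩) ?_ ?_ ?_ ?_ ?_
  · rintro ⟨⟨a, b⟩, ⟨c, d⟩⟩ h
    simp only [Finset.mem_sigma, Finset.HasAntidiagonal.mem_antidiagonal] at h ⊢
    refine ⟨?_, trivial⟩
    rw [← h.1, ← h.2]; abel
  · rintro ⟨⟨a, b⟩, ⟨c, d⟩⟩ h
    simp only [Finset.mem_sigma, Finset.HasAntidiagonal.mem_antidiagonal] at h ⊢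
    refine ⟨?_, trivial⟩
    rw [← h.1, ← h.2]; abel
  · rintro ⟨⟨a, b⟩, ⟨c, d⟩⟩ h
    simp only [Finset.mem_sigma, Finset.HasAntidiagonal.mem_antidiagonal] at h ⊢
    obtain ⟨-, rfl⟩ := h
    rfl
  · rintro ⟨⟨a, b⟩, ⟨c, d⟩⟩ h
    simp only [Finset.mem_sigma, Finset.HasAntidiagonal.mem_antidiagonal] at h ⊢
    obtain ⟨-, rfl⟩ := h
    rfl
  · rintro ⟨⟨a, b⟩, ⟨c, d⟩⟩ h
    simp [mul_comm]

/-- `Ann f = {r ∈ R | r ∘ f = 0}`. -/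
noncomputable def Ann (f : DP k) : Ideal (PS k) where
  carrier := {r | contract r f = 0}
  add_mem' {r s} hr hs := by
    simp only [Set.mem_ofPred_eq] at *
    simp [hr, hs]
  zero_mem' := by simp
  smul_mem' c r hr := by
    simp only [Set.mem_ofPred_eq] at *
    simp [contract_mul, hr]

/-- `𝔪^i ∘ f`, the space of the partials of `f` of order at least `i`. -/
noncomputable def partials (i : ℕ) (f : DP k) : Submodule k (DP k) :=
  ((IsLocalRing.maximalIdeal (PS k) ^ i).restrictScalars k).map (contract.flip f)

end DividedPowers

/-! ### Linear coordinates -/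

section Coordinates

variable {k : Type*} [Field k]

/-- The linear form `c₁ X₁ + c₂ X₂ + c₃ X₃` in `S₁`. -/
noncomputable def linForm (c : Fin 3 → k) : DP k :=
  ∑ t, Finsupp.single (Finsupp.single t 1) (c t)

/-- The divided power `L^[i]` of the linear form `L = c₁ X₁ + c₂ X₂ + c₃ X₃`:
the sum over `|m| = i` of `c₁^(m 0) c₂^(m 1) c₃^(m 2) X₁^[m 0] X₂^[m 1] X₃^[m 2]`. -/
noncomputable def dpPow (c : Fin 3 → k) (i : ℕ) : DP k :=
  ∑ m ∈ Finset.finsuppAntidiag Finset.univ i, Finsupp.single m (∏ t, c t ^ m t)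

/-- For a basis `X, Y, Z = b 0, b 1, b 2` of `S₁` (given by coefficient vectors), the element
`dualForm b 0`, `dualForm b 1`, `dualForm b 2` of the dual basis `x, y, z` of `R₁`. -/
noncomputable def dualForm (b : Module.Basis (Fin 3) k (Fin 3 → k)) (i : Fin 3) : PS k :=
  ∑ t, b.coord i (Pi.single t 1) • MvPowerSeries.X t

theorem hasSubst_dualForm (b : Module.Basis (Fin 3) k (Fin 3 → k)) :
    MvPowerSeries.HasSubst ![dualForm b 0, dualForm b 1] := by
  apply MvPowerSeries.hasSubst_of_constantCoeff_zero
  intro s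
  fin_cases s <;> simp [dualForm]

/-- The inclusion of `k{x, y}` in `R`, where `x, y` are the first two elements of the basis of
`R₁` dual to `b`: it sends the power series `p(x₁, x₂)` to `p(x, y)`. -/
noncomputable def coordSeries (b : Module.Basis (Fin 3) k (Fin 3 → k)) :
    MvPowerSeries (Fin 2) k →ₐ[k] PS k :=
  MvPowerSeries.substAlgHom (hasSubst_dualForm b)

variable (k) in
/-- `k{x, y}_{≥ 2}`: the power series in two variables without terms of degree less than `2`. -/
noncomputable def orderGE2 : Submodule k (MvPowerSeries (Fin 2) k) where
  carrier := {p | ∀ m : Fin 2 →₀ ℕ, m.degree < 2 → MvPowerSeries.coeff m p = 0}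
  add_mem' {p q} hp hq m hm := by simp [hp m hm, hq m hm]
  zero_mem' m _ := by simp
  smul_mem' c p hp m hm := by simp [hp m hm]

/-- The divided power subring `k_DP[X, Y]` of `S`, for `X, Y = b 0, b 1`. -/
noncomputable def dpXY (b : Module.Basis (Fin 3) k (Fin 3 → k)) : Submodule k (DP k) :=
  Submodule.span k (Set.range fun p : ℕ × ℕ => dpMul (dpPow (b 0) p.1) (dpPow (b 1) p.2))

/-- `f` is standard with respect to `X, Y, Z = b 0, b 1, b 2` and the degree `e`: for each `d > e`
the component `f_d` is in `k_DP[X, Y]`. -/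
def IsStandard (b : Module.Basis (Fin 3) k (Fin 3 → k)) (e : ℕ) (f : DP k) : Prop :=
  ∀ d, e < d → dpComp d f ∈ dpXY b

/-- `X, Y` are partials of `f` of order at least `e`, and `Z` is a partial of order `e - 1`. -/
def IsAdapted (b : Module.Basis (Fin 3) k (Fin 3 → k)) (e : ℕ) (f : DP k) : Prop :=
  linForm (b 0) ∈ partials e f ∧ linForm (b 1) ∈ partials e f ∧
    linForm (b 2) ∈ partials (e - 1) f ∧ linForm (b 2) ∉ partials e f

/-- The action `φ(F) = φ ∘ F` of `φ ∈ k{x, y}` on `S`. -/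
noncomputable def act (b : Module.Basis (Fin 3) k (Fin 3 → k)) (φ : MvPowerSeries (Fin 2) k) :
    DP k →ₗ[k] DP k :=
  contract (coordSeries b φ)

/-- `f_ex = Z φ(F) + Z^[2] φ²(F) + Z^[3] φ³(F) + ⋯`. For `φ` without constant term the terms
`Z^[i] φ^i(F)` with `i > deg F` are zero. -/
noncomputable def exoticPart (b : Module.Basis (Fin 3) k (Fin 3 → k))
    (φ : MvPowerSeries (Fin 2) k) (F : DP k) : DP k :=
  ∑ i ∈ Finset.Icc 1 (dpDeg F), dpMul (dpPow (b 2) i) (act b (φ ^ i) F)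

/-- The linear map `φ ↦ φ(F) mod S_{<e}` on `k{x, y}_{≥ 2}`. -/
noncomputable def exoticClass (b : Module.Basis (Fin 3) k (Fin 3 → k)) (e : ℕ) (F : DP k) :
    orderGE2 k →ₗ[k] DP k ⧸ dpLT k e :=
  (dpLT k e).mkQ ∘ₗ contract.flip F ∘ₗ (coordSeries b).toLinearMap ∘ₗ (orderGE2 k).subtype

/-- The space of exotic parameters
`V = {φ(F) mod S_{<e} | φ ∈ k{x, y}_{≥ 2}}`. -/
noncomputable abbrev ExoticSpace (b : Module.Basis (Fin 3) k (Fin 3 → k)) (e : ℕ) (F : DP k) :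
    Submodule k (DP k ⧸ dpLT k e) :=
  LinearMap.range (exoticClass b e F)

/-- The dual generator `f = F + f_ex` given by `φ ∈ k{x, y}_{≥ 2}`. -/
noncomputable def exoticGen (b : Module.Basis (Fin 3) k (Fin 3 → k)) (F : DP k)
    (φ : orderGE2 k) : DP k :=
  F + exoticPart b φ F

/-- The family `A(F)` of the algebras `R / Ann f`, `f = F + f_ex`, as a set of ideals: for every
exotic parameter `v` in the space `V`, the class of `φ(F)` modulo `S_{<e}`, the linear map `σ`
chooses a series `φ = σ v` that represents `v`. -/
def exoticFamily (b : Module.Basis (Fin 3) k (Fin 3 → k)) (e : ℕ) (F : DP k)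
    (σ : ExoticSpace b e F →ₗ[k] orderGE2 k) : Set (Ideal (PS k)) :=
  {I | ∃ v : ExoticSpace b e F, I = Ann (exoticGen b F (σ v))}

end Coordinates

end GorensteinDual

open GorensteinDual

/-!
The proof rests on the pairing `⟨r, F⟩ = (r ∘ F)(0)` of `R` with `S`, for which `S_{<d}` is the
orthogonal space of `𝔪^d` (`mem_dpLT_iff`). This replaces degrees and monomials by powers of `𝔪`,
which do not depend on coordinates. For instance, `f` is standard if and only if `z ∘ f ∈ S_{<e}`,
that is, `𝔪^e z ∘ f = 0`, where `e = j - a` (`isStandard_iff`).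

For `φ ∈ k{x, y}_{≥ 2}` let `θ` be the automorphism of `R` that fixes `x, y` and maps `z` to `z + φ`.
The operator `F ↦ F + f_ex(φ, F)` is the transpose of `θ` (`pairing_exoticGen`). So
`Ann f_φ = θ⁻¹(Ann f_st)`, the algebras `R / Ann f_φ` and `R / Ann f_st` are isomorphic, and they have
the same symmetric decomposition. As `θ (z - ψ) = z + φ - ψ` and `𝔪^e z ∘ f_st = 0`, the condition
`𝔪^e (z - ψ) ∘ f_φ = 0` says that `(φ - ψ)(f_st) ∈ S_{<e}` (`forall_mul_sub_mem_Ann_iff`). Hence the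
algebra determines the class of `φ`.

Conversely, for `f` with an adapted basis the linear forms in `𝔪^e ∘ f` are spanned by `X` and `Y`.
The top-degree form of each element of `𝔪^e ∘ f` then lies in `k_DP[X, Y]`, so an element orthogonal
to `k{x, y}_{≥ 2}` has degree at most `1`, and it is orthogonal to `z` too. By linear algebra `z`
agrees on `𝔪^e ∘ f` with some `φ ∈ k{x, y}_{≥ 2}` (`exists_contract_sub_mem_dpLT`), and undoing the
automorphism of this `φ` makes `f` standard.

Dimensions come from Gorenstein duality: for powers `M, N` of the maximal ideal `𝔪_A` of
`A = R / Ann f`, the spaces `M / (M ∩ (0 : N))` and `N / (N ∩ (0 : M))` are dual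
(`finrank_maxQuot_pow_add`). With `M = 𝔪_A^n`, `n = e, e - 1`, and `N = 𝔪_A, 𝔪_A^2` this turns the
values of `n_{a-1}` and `n_a` into the dimensions of the spaces of linear forms in `𝔪^e ∘ f` and
`𝔪^(e-1) ∘ f`. Moreover `V ≅ 𝔪_A^2 / (𝔪_A^2 ∩ (0 : 𝔪_A^e))` has the dimension of
`𝔪_A^e / (𝔪_A^e ∩ (0 : 𝔪_A^2))`, to which the sum of the `H(b)_u` telescopes
(`sum_sum_symDecomp_add_finrank`).
-/

namespace GorensteinDual

/-! ### Powers of the maximal ideal of a power series ring -/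

section PowerSeries

variable {k : Type*} [Field k] {σ : Type*}

theorem mem_maximalIdeal_iff_constantCoeff (r : MvPowerSeries σ k) :
    r ∈ IsLocalRing.maximalIdeal (MvPowerSeries σ k) ↔ MvPowerSeries.constantCoeff r = 0 := by
  rw [IsLocalRing.mem_maximalIdeal, mem_nonunits_iff, MvPowerSeries.isUnit_iff_constantCoeff,
    isUnit_iff_ne_zero, not_not]

theorem X_mem_maximalIdeal (i : σ) :
    (MvPowerSeries.X i : MvPowerSeries σ k) ∈ IsLocalRing.maximalIdeal (MvPowerSeries σ k) := by
  rw [mem_maximalIdeal_iff_constantCoeff, MvPowerSeries.constantCoeff_X]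

theorem monomial_mem_pow_maximalIdeal (n : σ →₀ ℕ) (c : k) :
    MvPowerSeries.monomial n c ∈ IsLocalRing.maximalIdeal (MvPowerSeries σ k) ^ n.degree := by
  classical
  induction n using Finsupp.induction_linear with
  | zero => simp
  | add p q hp hq =>
    have h : MvPowerSeries.monomial (p + q) c
        = MvPowerSeries.monomial p c * MvPowerSeries.monomial q (1 : k) := by
      rw [MvPowerSeries.monomial_mul_monomial, mul_one]
    by_cases hc : c = 0
    · simp [hc]
    have hq' : MvPowerSeries.monomial q (1 : k)
        = MvPowerSeries.C c⁻¹ * MvPowerSeries.monomial q c := by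
      rw [← MvPowerSeries.monomial_zero_eq_C_apply, MvPowerSeries.monomial_mul_monomial,
        zero_add, inv_mul_cancel₀ hc]
    rw [h, hq', map_add, pow_add]
    exact Ideal.mul_mem_mul hp (Ideal.mul_mem_left _ _ hq)
  | single i e =>
    have h : MvPowerSeries.monomial (Finsupp.single i e) c
        = MvPowerSeries.C c * (MvPowerSeries.X i : MvPowerSeries σ k) ^ e := by
      rw [MvPowerSeries.X_pow_eq, ← MvPowerSeries.monomial_zero_eq_C_apply,
        MvPowerSeries.monomial_mul_monomial, zero_add, mul_one]
    rw [h, Finsupp.degree_single]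
    exact Ideal.mul_mem_left _ _ (Ideal.pow_mem_pow (X_mem_maximalIdeal i) e)

/-- A series without terms of degree at most `d` is a combination of the variables whose
coefficients have no terms of degree less than `d`: every monomial is assigned to one of the
variables that divide it. -/
theorem exists_eq_sum_X_mul [Fintype σ] {d : ℕ} {r : MvPowerSeries σ k}
    (hr : ∀ m : σ →₀ ℕ, m.degree < d + 1 → MvPowerSeries.coeff m r = 0) :
    ∃ s : σ → MvPowerSeries σ k,
      (∀ i (m : σ →₀ ℕ), m.degree < d → MvPowerSeries.coeff m (s i) = 0) ∧
        r = ∑ i, MvPowerSeries.X i * s i := by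
  classical
  -- `Option` provides a value at `m = 0`, where no variable divides the monomial.
  have hc : ∀ m : σ →₀ ℕ, ∃ i : Option σ, m ≠ 0 → ∃ t, i = some t ∧ m t ≠ 0 := by
    intro m
    by_cases hm : m = 0
    · exact ⟨none, fun h => absurd hm h⟩
    · obtain ⟨t, ht⟩ := Finsupp.ne_iff.mp hm
      exact ⟨some t, fun _ => ⟨t, rfl, ht⟩⟩
  choose c hc using hc
  let s : σ → MvPowerSeries σ k := fun i m =>
    if c (m + Finsupp.single i 1) = some i then
      MvPowerSeries.coeff (m + Finsupp.single i 1) r else 0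
  have hs : ∀ i m, MvPowerSeries.coeff m (s i) =
      if c (m + Finsupp.single i 1) = some i then
        MvPowerSeries.coeff (m + Finsupp.single i 1) r else 0 := fun i m => rfl
  refine ⟨s, ?_, ?_⟩
  · intro i m hm
    rw [hs]
    split_ifs
    · exact hr _ (by simpa using hm)
    · rfl
  · ext m
    rw [map_sum]
    by_cases hm : m = 0
    · subst hm
      rw [hr 0 (by simp)]
      symm
      apply Finset.sum_eq_zero
      intro i _
      simp
    obtain ⟨t, ht, hmt⟩ := hc m hm
    have key : ∀ i, MvPowerSeries.coeff m (MvPowerSeries.X i * s i) =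
        if i = t then MvPowerSeries.coeff m r else 0 := by
      intro i
      rw [MvPowerSeries.X, MvPowerSeries.coeff_monomial_mul, one_mul]
      by_cases hi : Finsupp.single i 1 ≤ m
      · rw [if_pos hi, hs, tsub_add_cancel_of_le hi, ht]
        simp only [Option.some.injEq, eq_comm]
      · rw [if_neg hi, if_neg]
        rintro rfl
        apply hi
        rw [Finsupp.single_le_iff]
        omega
    simp [key]

theorem mem_pow_maximalIdeal_iff [Fintype σ] (d : ℕ) (r : MvPowerSeries σ k) :
    r ∈ IsLocalRing.maximalIdeal (MvPowerSeries σ k) ^ d ↔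
      ∀ m : σ →₀ ℕ, m.degree < d → MvPowerSeries.coeff m r = 0 := by
  constructor
  · intro h m hm
    have h1 : (d : ℕ∞) ≤ r.order := by
      induction d generalizing r m with
      | zero => simp
      | succ d ih =>
        rw [pow_succ'] at h
        refine Submodule.mul_induction_on h ?_ ?_
        · intro a ha b hb
          refine le_trans ?_ MvPowerSeries.le_order_mul
          have h1 : 1 ≤ a.order := MvPowerSeries.one_le_order_iff_constCoeff_eq_zero.mpr
            ((mem_maximalIdeal_iff_constantCoeff a).mp ha)
          have h2 : (d : ℕ∞) ≤ b.order := by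
            cases d with
            | zero => simp
            | succ d => exact ih b hb 0 (by simp)
          rw [Nat.cast_add, add_comm, Nat.cast_one]
          exact add_le_add h1 h2
        · intro a b ha hb
          exact le_trans (le_min ha hb) MvPowerSeries.min_order_le_add
    exact MvPowerSeries.coeff_of_lt_order (lt_of_lt_of_le (by exact_mod_cast hm) h1)
  · intro h
    induction d generalizing r with
    | zero => simp
    | succ d ih =>
      obtain ⟨s, hs, hr⟩ := exists_eq_sum_X_mul h
      rw [hr, pow_succ']
      exact Ideal.sum_mem _ fun i _ => Ideal.mul_mem_mul (X_mem_maximalIdeal i) (ih _ (hs i))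

/-- A homomorphism of `k`-algebras between power series rings is local, since the constant term
`c` of the image of a non-unit `r` would make `r - c` a non-unit. -/
theorem algHom_mem_pow_maximalIdeal {τ : Type*} (g : MvPowerSeries σ k →ₐ[k] MvPowerSeries τ k)
    {d : ℕ} {r : MvPowerSeries σ k}
    (hr : r ∈ IsLocalRing.maximalIdeal (MvPowerSeries σ k) ^ d) :
    g r ∈ IsLocalRing.maximalIdeal (MvPowerSeries τ k) ^ d := by
  have h1 : (IsLocalRing.maximalIdeal (MvPowerSeries σ k)).map (g : _ →+* _) ≤
      IsLocalRing.maximalIdeal (MvPowerSeries τ k) := by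
    rw [Ideal.map_le_iff_le_comap]
    intro s hs
    rw [Ideal.mem_comap, mem_maximalIdeal_iff_constantCoeff]
    by_contra hne
    set c := MvPowerSeries.constantCoeff ((g : _ →+* MvPowerSeries τ k) s) with hc
    have hu : IsUnit (s - algebraMap k _ c) := by
      rw [MvPowerSeries.isUnit_iff_constantCoeff, map_sub,
        (mem_maximalIdeal_iff_constantCoeff s).mp hs, isUnit_iff_ne_zero]
      simpa [MvPowerSeries.algebraMap_apply] using hne
    have hu' := hu.map g
    rw [MvPowerSeries.isUnit_iff_constantCoeff, isUnit_iff_ne_zero] at hu'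
    apply hu'
    rw [map_sub, map_sub, AlgHom.commutes, MvPowerSeries.algebraMap_apply]
    simp [hc]
  have h2 := Ideal.mem_map_of_mem (g : _ →+* MvPowerSeries τ k) hr
  rw [Ideal.map_pow] at h2
  exact Ideal.pow_right_mono h1 d h2

/-- The binomial theorem for a product of powers, indexed by multi-indices. -/
theorem prod_add_pow_eq_sum_antidiagonal [Fintype σ] [DecidableEq σ] {B : Type*} [CommSemiring B]
    (u v : σ → B) (n : σ →₀ ℕ) :
    ∏ i, (u i + v i) ^ n i = ∑ p ∈ Finset.HasAntidiagonal.antidiagonal n,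
      ((∏ i, (p.1 i + p.2 i).choose (p.1 i) : ℕ) : B) *
        ((∏ i, u i ^ p.1 i) * ∏ i, v i ^ p.2 i) := by
  have h : ∀ i, (u i + v i) ^ n i = ∑ m ∈ Finset.HasAntidiagonal.antidiagonal (n i),
      (n i).choose m.1 • (u i ^ m.1 * v i ^ m.2) := fun i => (Commute.all (u i) (v i)).add_pow' (n i)
  simp_rw [h]
  rw [Finset.prod_univ_sum]
  symm
  refine Finset.sum_bij' (fun p _ i => (p.1 i, p.2 i))
    (fun f _ => (Finsupp.equivFunOnFinite.symm fun i => (f i).1,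
      Finsupp.equivFunOnFinite.symm fun i => (f i).2)) ?_ ?_ ?_ ?_ ?_
  · intro p hp
    rw [Finset.HasAntidiagonal.mem_antidiagonal] at hp
    simp [Fintype.mem_piFinset, ← hp]
  · intro f hf
    rw [Fintype.mem_piFinset] at hf
    rw [Finset.HasAntidiagonal.mem_antidiagonal]
    ext i
    simpa using hf i
  · intro p _
    ext <;> simp
  · intro f _
    simp
  · intro p hp
    rw [Finset.HasAntidiagonal.mem_antidiagonal] at hp
    subst hp
    simp [nsmul_eq_mul, Finset.prod_mul_distrib]

end PowerSeries

/-! ### The pairing of power series with divided powers -/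

section Pairing

variable {k : Type*} [Field k]

/-- The bilinear pairing `⟨r, F⟩` of `R` and `S`, the constant term of `r ∘ F`. For it the monomials
`x^n` and the divided power monomials `X^[n]` are dual to each other. -/
noncomputable def pairing : PS k →ₗ[k] DP k →ₗ[k] k :=
  contract.compr₂ (Finsupp.lapply 0)

theorem pairing_apply (r : PS k) (F : DP k) : pairing r F = contract r F 0 := rfl

theorem pairing_single (r : PS k) (m : Fin 3 →₀ ℕ) (c : k) :
    pairing r (Finsupp.single m c) = c * MvPowerSeries.coeff m r := by
  rw [pairing_apply, contract_single, Finsupp.smul_apply, smul_eq_mul, Finsupp.finsetSum_apply]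
  congr 1
  rw [Finset.sum_eq_single (m, 0)]
  · simp
  · rintro ⟨p, q⟩ h hne
    rw [Finset.HasAntidiagonal.mem_antidiagonal] at h
    rw [Finsupp.single_apply, if_neg]
    rintro rfl
    apply hne
    simpa using h
  · simp

theorem pairing_eq_sum (r : PS k) (F : DP k) :
    pairing r F = F.sum fun m c => c * MvPowerSeries.coeff m r := by
  conv_lhs => rw [← Finsupp.sum_single F]
  rw [Finsupp.sum, map_sum]
  exact Finset.sum_congr rfl fun m _ => pairing_single r m _

theorem pairing_monomial (n : Fin 3 →₀ ℕ) (F : DP k) :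
    pairing (MvPowerSeries.monomial n 1) F = F n := by
  classical
  rw [pairing_eq_sum, Finsupp.sum]
  simp only [MvPowerSeries.coeff_monomial, mul_ite, mul_one, mul_zero]
  rw [Finset.sum_ite_eq']
  simp only [Finsupp.mem_support_iff, ite_eq_left_iff, not_not]
  exact fun h => h.symm

theorem pairing_mul (r s : PS k) (F : DP k) : pairing (r * s) F = pairing r (contract s F) := by
  rw [pairing_apply, contract_mul, pairing_apply]

theorem contract_apply (r : PS k) (F : DP k) (n : Fin 3 →₀ ℕ) :
    contract r F n = pairing (MvPowerSeries.monomial n 1 * r) F := by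
  rw [pairing_mul, pairing_monomial]

theorem contract_eq_zero_iff (r : PS k) (F : DP k) :
    contract r F = 0 ↔ ∀ s, pairing (s * r) F = 0 := by
  constructor
  · intro h s
    rw [pairing_mul, h, map_zero]
  · intro h
    ext n
    rw [contract_apply, h, Finsupp.zero_apply]

theorem mem_Ann_iff (r : PS k) (F : DP k) : r ∈ Ann F ↔ contract r F = 0 := Iff.rfl

theorem mem_dpLT_iff_apply (d : ℕ) (F : DP k) :
    F ∈ dpLT k d ↔ ∀ n : Fin 3 →₀ ℕ, d ≤ n.degree → F n = 0 := by
  rw [dpLT, Finsupp.mem_supported']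
  simp

/-- `S_{<d}` is the orthogonal space of `𝔪^d`. This describes `S_{<d}` without coordinates. -/
theorem mem_dpLT_iff (d : ℕ) (F : DP k) :
    F ∈ dpLT k d ↔ ∀ r ∈ IsLocalRing.maximalIdeal (PS k) ^ d, pairing r F = 0 := by
  rw [mem_dpLT_iff_apply]
  constructor
  · intro h r hr
    rw [pairing_eq_sum, Finsupp.sum]
    refine Finset.sum_eq_zero fun m _ => ?_
    rcases lt_or_ge m.degree d with hm | hm
    · rw [(mem_pow_maximalIdeal_iff d r).mp hr m hm, mul_zero]
    · rw [h m hm, zero_mul]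
  · intro h n hn
    rw [← pairing_monomial]
    exact h _ (Ideal.pow_le_pow_right hn (monomial_mem_pow_maximalIdeal n 1))

theorem contract_mem_dpLT_iff (d : ℕ) (r : PS k) (F : DP k) :
    contract r F ∈ dpLT k d ↔
      ∀ s ∈ IsLocalRing.maximalIdeal (PS k) ^ d, pairing (s * r) F = 0 := by
  simp only [mem_dpLT_iff, pairing_mul]

/-- An ideal whose multiples of `r` are orthogonal to `F` consists of elements that kill
`r ∘ F`. -/
theorem pairing_mul_eq_zero_iff_contract (J : Ideal (PS k)) (r : PS k) (F : DP k) :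
    (∀ s ∈ J, pairing (s * r) F = 0) ↔ ∀ s ∈ J, contract (s * r) F = 0 := by
  constructor
  · intro h s hs
    rw [contract_eq_zero_iff]
    intro t
    rw [← mul_assoc]
    exact h _ (J.mul_mem_left t hs)
  · intro h s hs
    rw [pairing_apply, h s hs, Finsupp.zero_apply]

theorem dpLT_mono {d e : ℕ} (h : d ≤ e) : dpLT k d ≤ dpLT k e := by
  intro F hF
  rw [mem_dpLT_iff_apply] at hF ⊢
  exact fun n hn => hF n (h.trans hn)

theorem mem_dpLT_dpDeg_succ (F : DP k) : F ∈ dpLT k (dpDeg F + 1) := by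
  rw [mem_dpLT_iff_apply]
  intro n hn
  by_contra h
  have : n.degree ≤ dpDeg F := Finset.le_sup (Finsupp.mem_support_iff.mpr h)
  omega

theorem pairing_eq_zero_of_mem_pow {N : ℕ} {r : PS k} {F : DP k} (hN : dpDeg F < N)
    (hr : r ∈ IsLocalRing.maximalIdeal (PS k) ^ N) : pairing r F = 0 :=
  (mem_dpLT_iff _ _).mp (mem_dpLT_dpDeg_succ F) _ (Ideal.pow_le_pow_right hN hr)

theorem contract_eq_zero_of_mem_pow {N : ℕ} {r : PS k} {F : DP k} (hN : dpDeg F < N)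
    (hr : r ∈ IsLocalRing.maximalIdeal (PS k) ^ N) : contract r F = 0 :=
  (contract_eq_zero_iff r F).mpr fun s =>
    pairing_eq_zero_of_mem_pow hN (Ideal.mul_mem_left _ s hr)

theorem ext_pairing {F G : DP k}
    (h : ∀ n, pairing (MvPowerSeries.monomial n 1) F = pairing (MvPowerSeries.monomial n 1) G) :
    F = G := by
  ext n
  simpa [pairing_monomial] using h n

theorem dpMul_apply (F G : DP k) (n : Fin 3 →₀ ℕ) :
    dpMul F G n = ∑ p ∈ Finset.HasAntidiagonal.antidiagonal n,
      ((∏ i, (p.1 i + p.2 i).choose (p.1 i) : ℕ) : k) * (F p.1 * G p.2) := by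
  classical
  induction F using Finsupp.induction_linear with
  | zero => simp
  | add F₁ F₂ h₁ h₂ =>
    simp only [map_add, LinearMap.add_apply, Finsupp.add_apply, h₁, h₂, add_mul, mul_add,
      Finset.sum_add_distrib]
  | single p a =>
    induction G using Finsupp.induction_linear with
    | zero => simp
    | add G₁ G₂ h₁ h₂ =>
      simp only [map_add, Finsupp.add_apply, h₁, h₂, mul_add, Finset.sum_add_distrib]
    | single q b =>
      simp only [dpMul, Finsupp.linearCombination_single, LinearMap.smul_apply,
        Finsupp.smul_apply, smul_eq_mul]
      by_cases h : p + q = n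
      · subst h
        rw [Finset.sum_eq_single (p, q)]
        · simp
          ring
        · rintro ⟨p', q'⟩ _ hne
          have : p' ≠ p ∨ q' ≠ q := by
            by_contra hcon
            push Not at hcon
            exact hne (Prod.ext hcon.1 hcon.2)
          rcases this with h | h
          · simp [Finsupp.single_apply, h.symm]
          · simp [Finsupp.single_apply, h.symm]
        · simp
      · rw [Finsupp.single_apply, if_neg h, mul_zero, mul_zero]
        symm
        apply Finset.sum_eq_zero
        rintro ⟨p', q'⟩ hmem
        rw [Finset.HasAntidiagonal.mem_antidiagonal] at hmem
        by_cases hp : p = p'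
        · have hq : q ≠ q' := by
            rintro rfl
            exact h (hp ▸ hmem)
          simp [Finsupp.single_apply, hq]
        · simp [Finsupp.single_apply, hp]

theorem dpPow_apply (c : Fin 3 → k) (i : ℕ) (m : Fin 3 →₀ ℕ) :
    dpPow c i m = if m.degree = i then ∏ t, c t ^ m t else 0 := by
  classical
  rw [dpPow, Finsupp.finsetSum_apply]
  simp only [Finsupp.single_apply]
  rw [Finset.sum_ite_eq']
  simp [Finset.mem_finsuppAntidiag, Finsupp.degree_eq_sum]

theorem pairing_linForm (r : PS k) (c : Fin 3 → k) :
    pairing r (linForm c) = ∑ t, c t * MvPowerSeries.coeff (Finsupp.single t 1) r := by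
  rw [linForm, map_sum]
  exact Finset.sum_congr rfl fun t _ => pairing_single _ _ _

/-- The partials of `F` are supported on the divisors of the monomials of `F`. -/
instance finite_range_contract_flip (F : DP k) :
    Module.Finite k (LinearMap.range (contract.flip F)) := by
  classical
  let s : Finset (Fin 3 →₀ ℕ) := F.support.biUnion Finset.Iic
  have hle : LinearMap.range (contract.flip F) ≤ Finsupp.supported k k (s : Set (Fin 3 →₀ ℕ)) := by
    rintro _ ⟨r, rfl⟩
    rw [Finsupp.mem_supported']
    intro n hn
    rw [LinearMap.flip_apply, contract_apply, pairing_eq_sum, Finsupp.sum]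
    refine Finset.sum_eq_zero fun m hm => ?_
    rw [MvPowerSeries.coeff_monomial_mul, if_neg, mul_zero]
    intro hnm
    apply hn
    rw [Finset.mem_coe, Finset.mem_biUnion]
    exact ⟨m, hm, Finset.mem_Iic.mpr hnm⟩
  have : Module.Finite k (Finsupp.supported k k (s : Set (Fin 3 →₀ ℕ))) :=
    Module.Finite.equiv (Finsupp.supportedEquivFinsupp (s : Set (Fin 3 →₀ ℕ))).symm
  exact Submodule.finiteDimensional_of_le hle

theorem mem_partials_iff (e : ℕ) (f u : DP k) :
    u ∈ partials e f ↔ ∃ r ∈ IsLocalRing.maximalIdeal (PS k) ^ e, contract r f = u := by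
  simp [partials]

theorem contract_mem_partials {e : ℕ} {f u : DP k} (r : PS k) (hu : u ∈ partials e f) :
    contract r u ∈ partials e f := by
  rw [mem_partials_iff] at hu ⊢
  obtain ⟨s, hs, rfl⟩ := hu
  exact ⟨r * s, Ideal.mul_mem_left _ r hs, contract_mul r s f⟩

instance finite_partials (e : ℕ) (f : DP k) : Module.Finite k (partials e f) := by
  refine Submodule.finiteDimensional_of_le (S₂ := LinearMap.range (contract.flip f)) ?_
  rintro _ ⟨r, -, rfl⟩
  exact ⟨r, rfl⟩

theorem exists_dual_eq_of_forall_eq_zero {U V : Type*} [AddCommGroup U] [Module k U]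
    [AddCommGroup V] [Module k V] [Module.Finite k V] (g : U →ₗ[k] Module.Dual k V)
    (P : Submodule k U) (r : U) (h : ∀ w, (∀ p ∈ P, g p w = 0) → g r w = 0) :
    ∃ p ∈ P, g p = g r := by
  have h1 : g r ∈ P.map g := by
    rw [← Subspace.dualCoannihilator_dualAnnihilator_eq (W := P.map g),
      Submodule.mem_dualAnnihilator]
    intro w hw
    rw [Submodule.mem_dualCoannihilator] at hw
    exact h w fun p hp => hw _ ⟨p, hp, rfl⟩
  exact h1

/-- On a finite-dimensional subspace `W` of `S` the power series `r` agrees with an element of the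
space `P` if the elements of `W` orthogonal to `P` are orthogonal to `r`. -/
theorem exists_pairing_eq_on (W : Submodule k (DP k)) [Module.Finite k W]
    (P : Submodule k (PS k)) (r : PS k)
    (h : ∀ w ∈ W, (∀ p ∈ P, pairing p w = 0) → pairing r w = 0) :
    ∃ p ∈ P, ∀ w ∈ W, pairing r w = pairing p w := by
  obtain ⟨p, hp, hpr⟩ := exists_dual_eq_of_forall_eq_zero (V := W)
    (W.subtype.dualMap ∘ₗ pairing) P r fun w hw => h w w.2 hw
  exact ⟨p, hp, fun w hw => (LinearMap.congr_fun hpr ⟨w, hw⟩).symm⟩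

end Pairing

/-! ### Linear coordinates and reduction to two variables -/

section LinearCoordinates

variable {k : Type*} [Field k] (b : Module.Basis (Fin 3) k (Fin 3 → k))

theorem coeff_dualForm (i t : Fin 3) :
    MvPowerSeries.coeff (Finsupp.single t 1) (dualForm b i) = b.coord i (Pi.single t 1) := by
  classical
  rw [dualForm, map_sum]
  simp only [map_smul, MvPowerSeries.coeff_X, smul_eq_mul, mul_ite, mul_one, mul_zero,
    Finsupp.single_left_inj one_ne_zero]
  simp

theorem dualForm_mem_maximalIdeal (i : Fin 3) :
    dualForm b i ∈ IsLocalRing.maximalIdeal (PS k) := by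
  rw [mem_maximalIdeal_iff_constantCoeff]
  simp [dualForm]

theorem sum_mul_coord_single (i : Fin 3) (c : Fin 3 → k) :
    ∑ t, c t * b.coord i (Pi.single t 1) = b.coord i c := by
  conv_rhs => rw [pi_eq_sum_univ' c, map_sum]
  simp only [map_smul, smul_eq_mul]

theorem pairing_dualForm_linForm (i : Fin 3) (c : Fin 3 → k) :
    pairing (dualForm b i) (linForm c) = b.coord i c := by
  simp only [pairing_linForm, coeff_dualForm, sum_mul_coord_single]

theorem X_eq_sum_smul_dualForm (t : Fin 3) :
    (MvPowerSeries.X t : PS k) = ∑ i, b i t • dualForm b i := by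
  classical
  have h : ∀ s, ∑ i, b i t * b.coord i (Pi.single s 1) = if s = t then 1 else 0 := by
    intro s
    have h1 := congrFun (b.sum_repr (Pi.single s 1)) t
    rw [Finset.sum_apply] at h1
    simp only [Pi.smul_apply, smul_eq_mul] at h1
    rw [Pi.single_apply] at h1
    simp only [Module.Basis.coord_apply, mul_comm (b _ t), h1, eq_comm]
  simp only [dualForm, Finset.smul_sum, smul_smul]
  rw [Finset.sum_comm]
  simp only [← Finset.sum_smul, h]
  simp

theorem coordSeries_X (i : Fin 2) :
    coordSeries b (MvPowerSeries.X i) = ![dualForm b 0, dualForm b 1] i :=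
  MvPowerSeries.substAlgHom_X (hasSubst_dualForm b) i

/-- The linear form in `k{x, y}` to which the coordinate `x_t` reduces modulo `z`. -/
noncomputable def planeForm (t : Fin 3) : MvPowerSeries (Fin 2) k :=
  b 0 t • MvPowerSeries.X 0 + b 1 t • MvPowerSeries.X 1

theorem planeForm_mem_maximalIdeal (t : Fin 3) :
    planeForm b t ∈ IsLocalRing.maximalIdeal (MvPowerSeries (Fin 2) k) := by
  rw [mem_maximalIdeal_iff_constantCoeff]
  simp [planeForm]

theorem coordSeries_planeForm (t : Fin 3) :
    coordSeries b (planeForm b t) = b 0 t • dualForm b 0 + b 1 t • dualForm b 1 := by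
  simp [planeForm, coordSeries_X]

theorem X_eq_coordSeries_add (t : Fin 3) :
    (MvPowerSeries.X t : PS k) = coordSeries b (planeForm b t) + b 2 t • dualForm b 2 := by
  rw [X_eq_sum_smul_dualForm b, coordSeries_planeForm, Fin.sum_univ_three]

theorem mem_orderGE2_iff (φ : MvPowerSeries (Fin 2) k) :
    φ ∈ orderGE2 k ↔ φ ∈ IsLocalRing.maximalIdeal (MvPowerSeries (Fin 2) k) ^ 2 :=
  (mem_pow_maximalIdeal_iff 2 φ).symm

theorem coordSeries_mem_sq (φ : orderGE2 k) :
    coordSeries b φ ∈ IsLocalRing.maximalIdeal (PS k) ^ 2 :=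
  algHom_mem_pow_maximalIdeal _ ((mem_orderGE2_iff _).mp φ.2)

/-- The homogeneous part of degree `d` of an element of `𝔪^d` is a form in `x, y` plus a multiple
of `z`. -/
theorem exists_coordSeries_add_mul_sub_mem_pow_succ (d : ℕ) (r : PS k)
    (hr : r ∈ IsLocalRing.maximalIdeal (PS k) ^ d) :
    ∃ φ ∈ IsLocalRing.maximalIdeal (MvPowerSeries (Fin 2) k) ^ d,
      ∃ s ∈ IsLocalRing.maximalIdeal (PS k) ^ (d - 1),
        r - (coordSeries b φ + dualForm b 2 * s) ∈
          IsLocalRing.maximalIdeal (PS k) ^ (d + 1) := by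
  -- The linear part of a series is a combination of `x, y` and `z`.
  have h1 : ∀ a ∈ IsLocalRing.maximalIdeal (PS k),
      ∃ φ ∈ IsLocalRing.maximalIdeal (MvPowerSeries (Fin 2) k), ∃ c : k,
        a - (coordSeries b φ + c • dualForm b 2) ∈ IsLocalRing.maximalIdeal (PS k) ^ 2 := by
    intro a ha
    obtain ⟨s, -, hs⟩ := exists_eq_sum_X_mul (d := 0) (r := a) (by
      rw [← mem_pow_maximalIdeal_iff]
      simpa using ha)
    let c : Fin 3 → k := fun i => MvPowerSeries.constantCoeff (s i)
    refine ⟨∑ t, c t • planeForm b t, Ideal.sum_mem _ fun t _ => ?_, ∑ t, c t * b 2 t, ?_⟩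
    · rw [Algebra.smul_def]
      exact Ideal.mul_mem_left _ _ (planeForm_mem_maximalIdeal b t)
    · have h2 : coordSeries b (∑ t, c t • planeForm b t) + (∑ t, c t * b 2 t) • dualForm b 2
          = ∑ t, MvPowerSeries.X t * MvPowerSeries.C (c t) := by
        rw [map_sum, Finset.sum_smul, ← Finset.sum_add_distrib]
        refine Finset.sum_congr rfl fun t _ => ?_
        rw [map_smul, mul_smul, ← smul_add, ← X_eq_coordSeries_add, mul_comm,
          MvPowerSeries.smul_eq_C_mul]
      rw [h2, hs, ← Finset.sum_sub_distrib]
      refine Ideal.sum_mem _ fun t _ => ?_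
      rw [← mul_sub, pow_two]
      refine Ideal.mul_mem_mul (X_mem_maximalIdeal t) ?_
      rw [mem_maximalIdeal_iff_constantCoeff]
      simp [c]
  induction d generalizing r with
  | zero =>
    refine ⟨MvPowerSeries.C (MvPowerSeries.constantCoeff r), by simp, 0, by simp, ?_⟩
    have h2 : coordSeries b (MvPowerSeries.C (MvPowerSeries.constantCoeff r))
        = MvPowerSeries.C (MvPowerSeries.constantCoeff r) :=
      (coordSeries b).commutes (MvPowerSeries.constantCoeff r)
    rw [h2, zero_add, pow_one, mem_maximalIdeal_iff_constantCoeff]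
    simp
  | succ d ih =>
    rw [pow_succ'] at hr
    refine Submodule.mul_induction_on hr ?_ ?_
    · intro u hu v hv
      obtain ⟨l, hl, c, hlc⟩ := h1 u hu
      obtain ⟨φ, hφ, s, hs, hφs⟩ := ih v hv
      have hz := dualForm_mem_maximalIdeal b 2
      have hιl : coordSeries b l ∈ IsLocalRing.maximalIdeal (PS k) := by
        have := algHom_mem_pow_maximalIdeal (coordSeries b) (d := 1) (by simpa using hl)
        simpa using this
      have hιφ := algHom_mem_pow_maximalIdeal (coordSeries b) hφ
      have hs' : ∀ w ∈ IsLocalRing.maximalIdeal (PS k),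
          w * s ∈ IsLocalRing.maximalIdeal (PS k) ^ d := by
        intro w hw
        rcases Nat.eq_zero_or_pos d with rfl | hd
        · simp
        · have := Ideal.mul_mem_mul hw hs
          rwa [← pow_succ', Nat.sub_add_cancel hd] at this
      refine ⟨l * φ, ?_, coordSeries b l * s + c • (coordSeries b φ + dualForm b 2 * s), ?_, ?_⟩
      · rw [pow_succ']
        exact Ideal.mul_mem_mul hl hφ
      · rw [Nat.add_sub_cancel, Algebra.smul_def]
        exact add_mem (hs' _ hιl) (Ideal.mul_mem_left _ _ (add_mem hιφ (hs' _ hz)))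
      · have h3 : u * v - (coordSeries b (l * φ) + dualForm b 2 *
            (coordSeries b l * s + c • (coordSeries b φ + dualForm b 2 * s)))
            = (u - (coordSeries b l + c • dualForm b 2)) * v
              + (coordSeries b l + c • dualForm b 2) *
                (v - (coordSeries b φ + dualForm b 2 * s)) := by
          rw [map_mul]
          simp only [Algebra.smul_def]
          ring
        rw [h3]
        refine add_mem ?_ ?_
        · have := Ideal.mul_mem_mul hlc hv
          rw [← pow_add] at this
          convert this using 2
          ring
        · rw [pow_succ' _ (d + 1)]
          refine Ideal.mul_mem_mul (add_mem hιl ?_) hφs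
          rw [Algebra.smul_def]
          exact Ideal.mul_mem_left _ _ hz
    · rintro u v ⟨φ, hφ, s, hs, h⟩ ⟨φ', hφ', s', hs', h'⟩
      refine ⟨φ + φ', add_mem hφ hφ', s + s', add_mem hs hs', ?_⟩
      have := add_mem h h'
      convert this using 1
      rw [map_add]
      ring

/-- Modulo a high power of `𝔪`, an element of `𝔪^d` is the sum of a series in `x, y` of order at
least `d` and of a multiple of `z` by an element of `𝔪^(d-1)`. -/
theorem exists_coordSeries_add_mul_sub_mem_pow (N d : ℕ) (r : PS k)
    (hr : r ∈ IsLocalRing.maximalIdeal (PS k) ^ d) :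
    ∃ φ ∈ IsLocalRing.maximalIdeal (MvPowerSeries (Fin 2) k) ^ d,
      ∃ s ∈ IsLocalRing.maximalIdeal (PS k) ^ (d - 1),
        r - (coordSeries b φ + dualForm b 2 * s) ∈ IsLocalRing.maximalIdeal (PS k) ^ N := by
  suffices h : ∃ φ ∈ IsLocalRing.maximalIdeal (MvPowerSeries (Fin 2) k) ^ d,
      ∃ s ∈ IsLocalRing.maximalIdeal (PS k) ^ (d - 1),
        r - (coordSeries b φ + dualForm b 2 * s) ∈
          IsLocalRing.maximalIdeal (PS k) ^ (d + N) by
    obtain ⟨φ, hφ, s, hs, h⟩ := h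
    exact ⟨φ, hφ, s, hs, Ideal.pow_le_pow_right (Nat.le_add_left N d) h⟩
  induction N with
  | zero => exact ⟨0, zero_mem _, 0, zero_mem _, by simpa using hr⟩
  | succ N ih =>
    obtain ⟨φ, hφ, s, hs, h⟩ := ih
    obtain ⟨φ', hφ', s', hs', h'⟩ := exists_coordSeries_add_mul_sub_mem_pow_succ b _ _ h
    refine ⟨φ + φ', add_mem hφ (Ideal.pow_le_pow_right (Nat.le_add_right d N) hφ'),
      s + s', add_mem hs (Ideal.pow_le_pow_right (by omega) hs'), ?_⟩
    rw [← add_assoc]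
    convert h' using 1
    rw [map_add]
    ring

/-! ### The divided power subring in two variables -/

theorem monomial_eq_prod (n : Fin 3 →₀ ℕ) :
    (MvPowerSeries.monomial n 1 : PS k) = ∏ t, MvPowerSeries.X t ^ n t := by
  rw [MvPowerSeries.monomial_one_eq]
  exact Finsupp.prod_fintype _ _ fun t => pow_zero _

theorem prod_smul_pow {B : Type*} [CommRing B] [Algebra k B] (c : Fin 3 → k) (u : B)
    (n : Fin 3 →₀ ℕ) : ∏ t, (c t • u) ^ n t = (∏ t, c t ^ n t) • u ^ n.degree := by
  simp only [smul_pow, Finset.prod_smul, Finset.prod_pow_eq_pow_sum, Finsupp.degree_eq_sum]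

/-- If `z ∘ G = 0` then `G` is the sum of the `⟨x^p y^q, G⟩ X^[p] Y^[q]`: against `G` the monomials
of `R` may be replaced by their reductions modulo `z`. -/
theorem mem_dpXY_of_contract_eq_zero {G : DP k} (hG : contract (dualForm b 2) G = 0) :
    G ∈ dpXY b := by
  classical
  have hz : ∀ n : Fin 3 →₀ ℕ, pairing (MvPowerSeries.monomial n 1) G
      = pairing (∏ t, (b 0 t • dualForm b 0 + b 1 t • dualForm b 1) ^ n t) G := by
    intro n
    have h1 : (MvPowerSeries.monomial n 1 : PS k)
        - ∏ t, (b 0 t • dualForm b 0 + b 1 t • dualForm b 1) ^ n t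
        ∈ Ideal.span {dualForm b 2} := by
      rw [← Ideal.Quotient.eq, monomial_eq_prod, map_prod, map_prod]
      refine Finset.prod_congr rfl fun t _ => ?_
      rw [map_pow, map_pow]
      congr 1
      rw [Ideal.Quotient.eq, X_eq_coordSeries_add b t, coordSeries_planeForm, add_sub_cancel_left,
        Ideal.mem_span_singleton, Algebra.smul_def]
      exact Dvd.intro_left _ rfl
    obtain ⟨s, hs⟩ := Ideal.mem_span_singleton'.mp h1
    rw [← sub_eq_zero, ← LinearMap.sub_apply, ← map_sub, ← hs, pairing_mul, hG, map_zero]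
  let N := dpDeg G
  have key : G = ∑ p ∈ Finset.range (N + 1), ∑ q ∈ Finset.range (N + 1),
      pairing (dualForm b 0 ^ p * dualForm b 1 ^ q) G •
        dpMul (dpPow (b 0) p) (dpPow (b 1) q) := by
    ext n
    rw [← pairing_monomial, hz, prod_add_pow_eq_sum_antidiagonal]
    simp only [Finsupp.finsetSum_apply, Finsupp.smul_apply, dpMul_apply, smul_eq_mul,
      Finset.mul_sum]
    simp_rw [Finset.sum_comm (s := Finset.range (N + 1))
      (t := Finset.HasAntidiagonal.antidiagonal n)]
    rw [map_sum, LinearMap.sum_apply]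
    refine Finset.sum_congr rfl fun m _ => ?_
    simp only [dpPow_apply, prod_smul_pow]
    rw [← nsmul_eq_mul, map_nsmul, LinearMap.smul_apply, smul_mul_smul_comm, map_smul,
      LinearMap.smul_apply, nsmul_eq_mul, smul_eq_mul]
    by_cases h : m.1.degree < N + 1 ∧ m.2.degree < N + 1
    · rw [Finset.sum_eq_single m.1.degree, Finset.sum_eq_single m.2.degree]
      · simp only [if_true]
        ring
      · intro q _ hq
        simp [hq.symm]
      · intro hq
        exact absurd (Finset.mem_range.mpr h.2) hq
      · intro p _ hp
        simp [hp.symm]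
      · intro hp
        exact absurd (Finset.mem_range.mpr h.1) hp
    · have hx := dualForm_mem_maximalIdeal b 0
      have hy := dualForm_mem_maximalIdeal b 1
      have h0 : pairing (dualForm b 0 ^ m.1.degree * dualForm b 1 ^ m.2.degree) G = 0 := by
        refine pairing_eq_zero_of_mem_pow (N := m.1.degree + m.2.degree) ?_ ?_
        · change N < _
          omega
        · rw [pow_add]
          exact Ideal.mul_mem_mul (Ideal.pow_mem_pow hx _) (Ideal.pow_mem_pow hy _)
      rw [h0, mul_zero, mul_zero]
      symm
      refine Finset.sum_eq_zero fun p _ => Finset.sum_eq_zero fun q _ => ?_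
      by_cases hp : m.1.degree = p
      · by_cases hq : m.2.degree = q
        · subst hp hq
          rw [h0, zero_mul]
        · simp [hq]
      · simp [hp]
  rw [key]
  exact Submodule.sum_mem _ fun p _ => Submodule.sum_mem _ fun q _ =>
    Submodule.smul_mem _ _ (Submodule.subset_span ⟨(p, q), rfl⟩)

/-- On polynomials, the pairing with `X^[p] Y^[q]` is the coefficient of `s^p t^q` after the
substitution `x ↦ s`, `y ↦ t`, `z ↦ 0`. -/
theorem contract_eq_zero_of_mem_dpXY {G : DP k} (hG : G ∈ dpXY b) :
    contract (dualForm b 2) G = 0 := by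
  classical
  suffices h : dpXY b ≤ LinearMap.ker (contract (dualForm b 2)) from h hG
  rw [dpXY, Submodule.span_le]
  rintro _ ⟨⟨p, q⟩, rfl⟩
  -- `e` is the exponent of `s^p t^q`, and `ρ` is the substitution.
  let e : Fin 2 →₀ ℕ := Finsupp.single 0 p + Finsupp.single 1 q
  let ρ : MvPolynomial (Fin 3) k →ₐ[k] MvPolynomial (Fin 2) k :=
    MvPolynomial.aeval fun t => b 0 t • MvPolynomial.X 0 + b 1 t • MvPolynomial.X 1
  have hmon : ∀ n : Fin 3 →₀ ℕ, MvPolynomial.coeff e (ρ (MvPolynomial.monomial n 1))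
      = dpMul (dpPow (b 0) p) (dpPow (b 1) q) n := by
    intro n
    rw [MvPolynomial.aeval_monomial, map_one, one_mul, Finsupp.prod_fintype _ _ fun t => pow_zero _,
      prod_add_pow_eq_sum_antidiagonal, MvPolynomial.coeff_sum, dpMul_apply]
    refine Finset.sum_congr rfl fun m _ => ?_
    rw [prod_smul_pow, prod_smul_pow, smul_mul_smul_comm, ← nsmul_eq_mul, MvPolynomial.coeff_smul,
      MvPolynomial.coeff_smul, nsmul_eq_mul, smul_eq_mul, dpPow_apply, dpPow_apply,
      MvPolynomial.X_pow_eq_monomial, MvPolynomial.X_pow_eq_monomial, MvPolynomial.monomial_mul,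
      MvPolynomial.coeff_monomial]
    have he : (Finsupp.single 0 m.1.degree + Finsupp.single 1 m.2.degree = e) ↔
        (m.1.degree = p ∧ m.2.degree = q) := by
      constructor
      · intro h
        have h0 := DFunLike.congr_fun h 0
        have h1 := DFunLike.congr_fun h 1
        simpa [e] using And.intro h0 h1
      · rintro ⟨h0, h1⟩
        rw [h0, h1]
    rw [mul_one, if_congr he rfl rfl]
    by_cases hp : m.1.degree = p <;> by_cases hq : m.2.degree = q <;> simp [hp, hq]
  have hz : ∑ t, b.coord 2 (Pi.single t 1) • ρ (MvPolynomial.X t) = 0 := by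
    simp only [ρ, MvPolynomial.aeval_X, smul_add, smul_smul, Finset.sum_add_distrib,
      ← Finset.sum_smul, mul_comm (b.coord 2 _), sum_mul_coord_single]
    simp
  rw [SetLike.mem_coe, LinearMap.mem_ker]
  ext n
  have h1 : (MvPowerSeries.monomial n 1 : PS k) * dualForm b 2
      = ∑ t, b.coord 2 (Pi.single t 1) • MvPowerSeries.monomial (n + Finsupp.single t 1) 1 := by
    rw [dualForm, Finset.mul_sum]
    refine Finset.sum_congr rfl fun t _ => ?_
    rw [mul_smul_comm, MvPowerSeries.X, MvPowerSeries.monomial_mul_monomial, one_mul]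
  rw [contract_apply, h1, map_sum, LinearMap.sum_apply]
  simp only [map_smul, LinearMap.smul_apply, pairing_monomial, ← hmon]
  have h2 : ∀ t, ρ (MvPolynomial.monomial (n + Finsupp.single t 1) 1)
      = ρ (MvPolynomial.monomial n 1) * ρ (MvPolynomial.X t) := by
    intro t
    rw [← map_mul, MvPolynomial.X, MvPolynomial.monomial_mul, one_mul]
  simp only [h2, ← MvPolynomial.coeff_smul, ← mul_smul_comm]
  rw [← MvPolynomial.coeff_sum, ← Finset.mul_sum, hz, mul_zero, MvPolynomial.coeff_zero,
    Finsupp.zero_apply]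

theorem contract_dpComp_succ (i : Fin 3) (d : ℕ) (F : DP k) :
    contract (dualForm b i) (dpComp (d + 1) F) = dpComp d (contract (dualForm b i) F) := by
  classical
  have h1 : ∀ (G : DP k) (n : Fin 3 →₀ ℕ), contract (dualForm b i) G n
      = ∑ t, b.coord i (Pi.single t 1) * G (n + Finsupp.single t 1) := by
    intro G n
    rw [contract_apply, dualForm, Finset.mul_sum, map_sum, LinearMap.sum_apply]
    refine Finset.sum_congr rfl fun t _ => ?_
    rw [mul_smul_comm, MvPowerSeries.X, MvPowerSeries.monomial_mul_monomial, one_mul, map_smul,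
      LinearMap.smul_apply, pairing_monomial, smul_eq_mul]
  ext n
  rw [h1]
  simp only [dpComp, Finsupp.filter_apply, map_add, Finsupp.degree_single, Nat.add_right_cancel_iff]
  split_ifs
  · rw [h1]
  · simp

/-- The coordinate-free form of being standard: `z ∘ f` has degree less than `e`. -/
theorem isStandard_iff (e : ℕ) (F : DP k) :
    IsStandard b e F ↔ contract (dualForm b 2) F ∈ dpLT k e := by
  constructor
  · intro h
    rw [mem_dpLT_iff_apply]
    intro n hn
    have h1 := contract_eq_zero_of_mem_dpXY b (h (n.degree + 1) (by omega))
    rw [contract_dpComp_succ] at h1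
    have h2 := DFunLike.congr_fun h1 n
    simpa [dpComp] using h2
  · intro h d hd
    obtain ⟨d, rfl⟩ : ∃ d', d = d' + 1 := ⟨d - 1, by omega⟩
    refine mem_dpXY_of_contract_eq_zero b ?_
    rw [contract_dpComp_succ]
    ext n
    simp only [dpComp, Finsupp.filter_apply, Finsupp.zero_apply]
    split_ifs with hn
    · exact (mem_dpLT_iff_apply _ _).mp h n (by omega)
    · rfl

end LinearCoordinates

/-! ### The automorphism behind the exotic terms -/

section Shear

variable {k : Type*} [Field k] (b : Module.Basis (Fin 3) k (Fin 3 → k))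

theorem hasSubst_shear (φ : orderGE2 k) :
    MvPowerSeries.HasSubst fun t : Fin 3 =>
      (MvPowerSeries.X t : PS k) + b 2 t • coordSeries b φ := by
  apply MvPowerSeries.hasSubst_of_constantCoeff_zero
  intro t
  have h1 := (mem_maximalIdeal_iff_constantCoeff _).mp
    (Ideal.pow_le_self two_ne_zero (coordSeries_mem_sq b φ))
  rw [map_add, MvPowerSeries.constantCoeff_X, zero_add, MvPowerSeries.smul_eq_C_mul, map_mul, h1,
    mul_zero]

/-- The endomorphism of `R` that fixes `x` and `y` and maps `z` to `z + φ(x, y)`. -/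
noncomputable def shear (φ : orderGE2 k) : PS k →ₐ[k] PS k :=
  MvPowerSeries.substAlgHom (hasSubst_shear b φ)

theorem shear_X (φ : orderGE2 k) (t : Fin 3) :
    shear b φ (MvPowerSeries.X t) = MvPowerSeries.X t + b 2 t • coordSeries b φ :=
  MvPowerSeries.substAlgHom_X (hasSubst_shear b φ) t

theorem shear_dualForm (φ : orderGE2 k) (i : Fin 3) :
    shear b φ (dualForm b i) = dualForm b i + b.coord i (b 2) • coordSeries b φ := by
  rw [← sum_mul_coord_single, dualForm, map_sum, Finset.sum_smul, ← Finset.sum_add_distrib]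
  refine Finset.sum_congr rfl fun t _ => ?_
  rw [map_smul, shear_X, smul_add, smul_smul, mul_comm (b 2 t)]

theorem shear_coordSeries (φ : orderGE2 k) (ψ : MvPowerSeries (Fin 2) k) :
    shear b φ (coordSeries b ψ) = coordSeries b ψ := by
  refine (MvPowerSeries.substAlgHom_comp_substAlgHom_apply (hasSubst_dualForm b)
    (hasSubst_shear b φ) ψ).trans ?_
  change _ = MvPowerSeries.substAlgHom (hasSubst_dualForm b) ψ
  rw [MvPowerSeries.substAlgHom_apply, MvPowerSeries.substAlgHom_apply]
  congr 1
  funext i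
  change shear b φ (![dualForm b 0, dualForm b 1] i) = _
  fin_cases i <;> simp [shear_dualForm]

theorem shear_dualForm_two (φ : orderGE2 k) :
    shear b φ (dualForm b 2) = dualForm b 2 + coordSeries b φ := by
  simp [shear_dualForm]

theorem shear_neg_shear (φ : orderGE2 k) (r : PS k) : shear b (-φ) (shear b φ r) = r := by
  rw [shear, shear, MvPowerSeries.substAlgHom_comp_substAlgHom_apply,
    MvPowerSeries.substAlgHom_apply]
  conv_rhs => rw [← id_eq r, ← MvPowerSeries.subst_self]
  congr 1
  funext t
  change shear b (-φ) (MvPowerSeries.X t + b 2 t • coordSeries b φ) = _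
  rw [map_add, map_smul, shear_X, shear_coordSeries]
  simp

theorem shear_shear_neg (φ : orderGE2 k) (r : PS k) : shear b φ (shear b (-φ) r) = r := by
  simpa using shear_neg_shear b (-φ) r

/-- The automorphism `z ↦ z + φ` of `R`, with inverse `z ↦ z - φ`. -/
noncomputable def shearEquiv (φ : orderGE2 k) : PS k ≃ₐ[k] PS k :=
  AlgEquiv.ofAlgHom (shear b φ) (shear b (-φ))
    (AlgHom.ext (shear_shear_neg b φ)) (AlgHom.ext (shear_neg_shear b φ))

theorem shear_mem_pow {φ : orderGE2 k} {d : ℕ} {r : PS k}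
    (hr : r ∈ IsLocalRing.maximalIdeal (PS k) ^ d) :
    shear b φ r ∈ IsLocalRing.maximalIdeal (PS k) ^ d :=
  algHom_mem_pow_maximalIdeal _ hr

theorem sub_sum_monomial_mem_pow (N : ℕ) (r : PS k) :
    r - ∑ m ∈ (Finset.range N).biUnion (Finset.finsuppAntidiag Finset.univ),
        MvPowerSeries.monomial m (MvPowerSeries.coeff m r) ∈
      IsLocalRing.maximalIdeal (PS k) ^ N := by
  classical
  rw [mem_pow_maximalIdeal_iff]
  intro n hn
  rw [map_sub, map_sum]
  simp only [MvPowerSeries.coeff_monomial]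
  rw [Finset.sum_ite_eq, if_pos, sub_self]
  simp [Finset.mem_finsuppAntidiag, ← Finsupp.degree_eq_sum, hn]

/-- Linear forms on `R` that vanish on a power of `𝔪` are equal if they agree on monomials. -/
theorem eq_of_eq_on_monomial {N : ℕ} {u v : PS k →ₗ[k] k}
    (hu : ∀ r ∈ IsLocalRing.maximalIdeal (PS k) ^ N, u r = 0)
    (hv : ∀ r ∈ IsLocalRing.maximalIdeal (PS k) ^ N, v r = 0)
    (h : ∀ n, u (MvPowerSeries.monomial n 1) = v (MvPowerSeries.monomial n 1)) : u = v := by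
  ext r
  have h1 := sub_sum_monomial_mem_pow N r
  have hu1 := hu _ h1
  have hv1 := hv _ h1
  rw [map_sub, sub_eq_zero] at hu1 hv1
  rw [hu1, hv1, map_sum, map_sum]
  refine Finset.sum_congr rfl fun m _ => ?_
  have h2 : (MvPowerSeries.monomial m (MvPowerSeries.coeff m r) : PS k)
      = MvPowerSeries.coeff m r • MvPowerSeries.monomial m 1 := by
    rw [← map_smul, smul_eq_mul, mul_one]
  rw [h2, map_smul, map_smul, h]

theorem act_pow_eq_zero (φ : orderGE2 k) (F : DP k) {i : ℕ} (hi : dpDeg F < i) :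
    act b ((φ : MvPowerSeries (Fin 2) k) ^ i) F = 0 := by
  refine contract_eq_zero_of_mem_pow hi ?_
  rw [map_pow]
  exact Ideal.pow_mem_pow (Ideal.pow_le_self two_ne_zero (coordSeries_mem_sq b φ)) i

theorem exoticGen_eq_sum (F : DP k) (φ : orderGE2 k) :
    exoticGen b F φ = ∑ i ∈ Finset.range (dpDeg F + 1),
      dpMul (dpPow (b 2) i) (act b ((φ : MvPowerSeries (Fin 2) k) ^ i) F) := by
  have h0 : dpMul (dpPow (b 2) 0) (act b ((φ : MvPowerSeries (Fin 2) k) ^ 0) F) = F := by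
    have h1 : act b ((φ : MvPowerSeries (Fin 2) k) ^ 0) F = F := by
      ext n
      rw [act, pow_zero, map_one, contract_apply, mul_one, pairing_monomial]
    rw [h1]
    ext n
    rw [dpMul_apply, Finset.sum_eq_single (0, n)]
    · simp [dpPow_apply]
    · rintro ⟨p, q⟩ hm hne
      rw [Finset.HasAntidiagonal.mem_antidiagonal] at hm
      rw [dpPow_apply, if_neg]
      · simp
      · intro hp
        rw [Finsupp.degree_eq_zero_iff] at hp
        apply hne
        simp only at hp hm
        subst hp
        simpa using hm
    · simp
  rw [exoticGen, exoticPart, Finset.range_eq_Ico, Finset.sum_eq_sum_Ico_succ_bot (by omega), h0]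
  rfl

/-- The element `f_φ = F + f_ex` of `S` is the image of `F` under the transpose of the automorphism
`z ↦ z + φ` of `R`. -/
theorem pairing_exoticGen (F : DP k) (φ : orderGE2 k) (r : PS k) :
    pairing r (exoticGen b F φ) = pairing (shear b φ r) F := by
  classical
  suffices h : (pairing (k := k)).flip (exoticGen b F φ)
      = (pairing (k := k)).flip F ∘ₗ (shear b φ).toLinearMap from LinearMap.congr_fun h r
  -- On monomials the formula is the binomial expansion of the products of the `x_t + c_t φ`.
  refine eq_of_eq_on_monomial (N := dpDeg F + dpDeg (exoticGen b F φ) + 1) ?_ ?_ ?_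
  · intro s hs
    exact pairing_eq_zero_of_mem_pow (by omega) hs
  · intro s hs
    exact pairing_eq_zero_of_mem_pow (by omega) (shear_mem_pow b hs)
  · intro n
    change pairing _ (exoticGen b F φ) = pairing (shear b φ _) F
    have hprod : shear b φ (MvPowerSeries.monomial n 1)
        = ∏ t, (b 2 t • coordSeries b φ + MvPowerSeries.X t) ^ n t := by
      rw [monomial_eq_prod, map_prod]
      refine Finset.prod_congr rfl fun t _ => ?_
      rw [map_pow, shear_X, add_comm]
    rw [pairing_monomial, exoticGen_eq_sum, Finsupp.finsetSum_apply, hprod,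
      prod_add_pow_eq_sum_antidiagonal, map_sum, LinearMap.sum_apply]
    simp only [dpMul_apply]
    rw [Finset.sum_comm]
    refine Finset.sum_congr rfl fun m _ => ?_
    rw [← nsmul_eq_mul, map_nsmul, LinearMap.smul_apply, prod_smul_pow, smul_mul_assoc, map_smul,
      LinearMap.smul_apply, nsmul_eq_mul, smul_eq_mul, ← monomial_eq_prod, mul_comm (_ ^ _),
      ← map_pow, pairing_mul, pairing_monomial, ← Finset.mul_sum]
    congr 1
    simp only [dpPow_apply]
    change _ = _ * act b _ F m.2
    by_cases h : m.1.degree < dpDeg F + 1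
    · rw [Finset.sum_eq_single m.1.degree]
      · simp
      · intro i _ hi
        simp [hi.symm]
      · intro hi
        exact absurd (Finset.mem_range.mpr h) hi
    · rw [act_pow_eq_zero b φ F (by omega), Finsupp.zero_apply, mul_zero]
      refine Finset.sum_eq_zero fun i hi => ?_
      rw [Finset.mem_range] at hi
      rw [if_neg (by omega), zero_mul]

theorem mem_Ann_exoticGen_iff (F : DP k) (φ : orderGE2 k) (r : PS k) :
    r ∈ Ann (exoticGen b F φ) ↔ shear b φ r ∈ Ann F := by
  rw [mem_Ann_iff, mem_Ann_iff, contract_eq_zero_iff, contract_eq_zero_iff]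
  simp only [pairing_exoticGen, map_mul]
  constructor
  · intro h s
    have := h (shear b (-φ) s)
    rwa [shear_shear_neg] at this
  · exact fun h s => h _

theorem exoticGen_neg_exoticGen (F : DP k) (φ : orderGE2 k) :
    exoticGen b (exoticGen b F (-φ)) φ = F :=
  ext_pairing fun n => by rw [pairing_exoticGen, pairing_exoticGen, shear_neg_shear]

theorem exoticPart_zero (F : DP k) : exoticPart b 0 F = 0 := by
  refine Finset.sum_eq_zero fun i hi => ?_
  rw [Finset.mem_Icc] at hi
  rw [zero_pow (by omega), act, map_zero, map_zero, LinearMap.zero_apply, map_zero]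

end Shear

/-! ### Lengths in a finite-dimensional local algebra -/

section Lengths

variable {k : Type*} [Field k] {A : Type*} [CommRing A] [Algebra k A]

theorem finrank_map_add_finrank_inf_ker {M Q : Type*} [AddCommGroup M] [Module A M] [Module k M]
    [IsScalarTower k A M] [AddCommGroup Q] [Module A Q] [Module k Q] [IsScalarTower k A Q]
    [Module.Finite k M] (f : M →ₗ[A] Q) (P : Submodule A M) :
    Module.finrank k (P.map f) + Module.finrank k ↥(P ⊓ LinearMap.ker f) =
      Module.finrank k P := by
  let g : ↥(P.restrictScalars k) →ₗ[k] Q := (f.restrictScalars k).domRestrict (P.restrictScalars k)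
  have : Module.Finite k ↥(P.restrictScalars k) :=
    FiniteDimensional.finiteDimensional_submodule _
  have h := LinearMap.finrank_range_add_finrank_ker g
  have h1 : LinearMap.range g = (P.map f).restrictScalars k := by
    ext q
    simp [g]
  have h2 : (LinearMap.ker g).map (P.restrictScalars k).subtype
      = (P ⊓ LinearMap.ker f).restrictScalars k := by
    ext m
    simp [g, and_comm]
  have h3 := LinearEquiv.finrank_eq ((LinearMap.ker g).equivMapOfInjective
    (P.restrictScalars k).subtype (Submodule.injective_subtype _))
  rw [h1, h3, h2] at h
  exact h

theorem finrank_submoduleOf {M : Type*} [AddCommGroup M] [Module A M] [Module k M]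
    [IsScalarTower k A M] (P N : Submodule A M) :
    Module.finrank k (P.submoduleOf N) = Module.finrank k ↥(N ⊓ P) := by
  have h : (P.submoduleOf N).map N.subtype = N ⊓ P := Submodule.map_comap_subtype N P
  rw [← h]
  exact LinearEquiv.finrank_eq (((P.submoduleOf N).equivMapOfInjective N.subtype
    (Submodule.injective_subtype _)).restrictScalars k)

theorem finrank_quotient_submoduleOf_add {M : Type*} [AddCommGroup M] [Module A M] [Module k M]
    [IsScalarTower k A M] [Module.Finite k M] {N' N : Submodule A M} (h : N' ≤ N) :
    Module.finrank k (↥N ⧸ N'.submoduleOf N) + Module.finrank k N' = Module.finrank k N := by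
  have : Module.Finite k N :=
    FiniteDimensional.finiteDimensional_submodule (N.restrictScalars k)
  have h1 := finrank_map_add_finrank_inf_ker (k := k) (N'.submoduleOf N).mkQ ⊤
  rw [Submodule.map_top, Submodule.range_mkQ, top_inf_eq, Submodule.ker_mkQ, finrank_submoduleOf,
    inf_eq_right.mpr h] at h1
  have h2 : ∀ (M' : Type _) [AddCommGroup M'] [Module A M'] [Module k M'] [IsScalarTower k A M'],
      Module.finrank k (⊤ : Submodule A M') = Module.finrank k M' := fun M' _ _ _ _ =>
    LinearEquiv.finrank_eq (Submodule.topEquiv.restrictScalars k)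
  rwa [h2, h2] at h1

theorem loewy_mono (𝔪 : Ideal A) {d e : ℕ} (h : d ≤ e) : loewy 𝔪 d ≤ loewy 𝔪 e :=
  Submodule.annihilator_mono (Ideal.pow_le_pow_right h)

theorem pow_le_loewy (𝔪 : Ideal A) {i e d : ℕ} (hd : 𝔪 ^ d = ⊥) (h : d ≤ i + e) :
    𝔪 ^ i ≤ loewy 𝔪 e := by
  intro x hx
  rw [loewy, Submodule.mem_annihilator]
  intro y hy
  have h1 := Ideal.mul_mem_mul hx hy
  rw [← pow_add] at h1
  have h2 := Ideal.pow_le_pow_right h h1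
  rw [hd] at h2
  exact h2

theorem loewyFiltration_succ_le (𝔪 : Ideal A) (j a i : ℕ) :
    loewyFiltration 𝔪 j (a + 1) i ≤ loewyFiltration 𝔪 j a i :=
  Submodule.map_mono (Submodule.comap_mono (loewy_mono 𝔪 (by omega)))

theorem loewyFiltration_zero (𝔪 : Ideal A) {j i : ℕ} (hj : 𝔪 ^ (j + 1) = ⊥) :
    loewyFiltration 𝔪 j 0 i = ⊤ := by
  have h : 𝔪 ^ i ≤ loewy 𝔪 (j + 1 - 0 - i) := pow_le_loewy 𝔪 hj (by omega)
  have h1 : (loewy 𝔪 (j + 1 - 0 - i)).submoduleOf (𝔪 ^ i) = ⊤ :=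
    Submodule.comap_subtype_eq_top.mpr h
  rw [loewyFiltration, h1, Submodule.map_top, Submodule.range_mkQ]

theorem finrank_loewyFiltration_zero (𝔪 : Ideal A) {j i : ℕ} (hj : 𝔪 ^ (j + 1) = ⊥) :
    Module.finrank k (loewyFiltration 𝔪 j 0 i) = hilb k 𝔪 i := by
  rw [loewyFiltration_zero 𝔪 hj]
  exact LinearEquiv.finrank_eq (Submodule.topEquiv.restrictScalars k)

section Filtration

variable [Module.Finite k A] (𝔪 : Ideal A)

theorem hilb_add_finrank (i : ℕ) :
    hilb k 𝔪 i + Module.finrank k ↥(𝔪 ^ (i + 1)) = Module.finrank k ↥(𝔪 ^ i) :=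
  finrank_quotient_submoduleOf_add (Ideal.pow_le_pow_right (Nat.le_succ i))

instance finite_ideal (I : Ideal A) : Module.Finite k I :=
  FiniteDimensional.finiteDimensional_submodule (I.restrictScalars k)

instance finite_grPiece (i : ℕ) : Module.Finite k (GrPiece 𝔪 i) := by
  let f : ↥(𝔪 ^ i) →ₗ[k] GrPiece 𝔪 i :=
    ((𝔪 ^ (i + 1)).submoduleOf (𝔪 ^ i)).mkQ.restrictScalars k
  have hf : Function.Surjective f :=
    Submodule.mkQ_surjective ((𝔪 ^ (i + 1)).submoduleOf (𝔪 ^ i))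
  exact Module.Finite.of_surjective f hf

/-- The dimension of `C(a)_i` as a difference of dimensions of ideals. -/
theorem finrank_loewyFiltration_add (j a i : ℕ) :
    Module.finrank k (loewyFiltration 𝔪 j a i) +
        Module.finrank k ↥(𝔪 ^ (i + 1) ⊓ loewy 𝔪 (j + 1 - a - i)) =
      Module.finrank k ↥(𝔪 ^ i ⊓ loewy 𝔪 (j + 1 - a - i)) := by
  have h := finrank_map_add_finrank_inf_ker (k := k) ((𝔪 ^ (i + 1)).submoduleOf (𝔪 ^ i)).mkQ
    ((loewy 𝔪 (j + 1 - a - i)).submoduleOf (𝔪 ^ i))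
  have h1 : (loewy 𝔪 (j + 1 - a - i)).submoduleOf (𝔪 ^ i) ⊓
      (𝔪 ^ (i + 1)).submoduleOf (𝔪 ^ i)
      = (𝔪 ^ (i + 1) ⊓ loewy 𝔪 (j + 1 - a - i)).submoduleOf (𝔪 ^ i) := by
    rw [inf_comm]
    rfl
  rw [Submodule.ker_mkQ, h1, finrank_submoduleOf, finrank_submoduleOf, ← inf_assoc,
    inf_eq_right.mpr (Ideal.pow_le_pow_right (Nat.le_succ i))] at h
  exact h

theorem symDecomp_add_finrank (j a i : ℕ) :
    symDecomp k 𝔪 j a i + Module.finrank k (loewyFiltration 𝔪 j (a + 1) i) =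
      Module.finrank k (loewyFiltration 𝔪 j a i) :=
  finrank_quotient_submoduleOf_add (loewyFiltration_succ_le 𝔪 j a i)

theorem sum_symDecomp_add_finrank (j i n : ℕ) :
    ∑ c ∈ Finset.range n, symDecomp k 𝔪 j c i + Module.finrank k (loewyFiltration 𝔪 j n i) =
      Module.finrank k (loewyFiltration 𝔪 j 0 i) := by
  induction n with
  | zero => simp
  | succ n ih =>
    rw [Finset.sum_range_succ, ← ih, ← symDecomp_add_finrank 𝔪 j n i]
    ring

/-- The sum of the entries `H(c)_u` with `c < a` and `j-a ≤ u ≤ j-c-2`. For fixed `u` the sum over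
`c` telescopes to `dim C(0)_u - dim C(j-1-u)_u`, where `C(j-1-u)_u` is given by `(0 : 𝔪^2)`;
the sum over `u` telescopes again. -/
theorem sum_sum_symDecomp_add_finrank {j a : ℕ} (ha : 1 ≤ a) (haj : a + 2 ≤ j)
    (hj : 𝔪 ^ (j + 1) = ⊥) :
    ∑ c ∈ Finset.range a, ∑ u ∈ Finset.Icc (j - a) (j - c - 2), symDecomp k 𝔪 j c u +
        Module.finrank k ↥(𝔪 ^ (j - a) ⊓ loewy 𝔪 2) =
      Module.finrank k ↥(𝔪 ^ (j - a)) := by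
  have hswap : ∑ c ∈ Finset.range a, ∑ u ∈ Finset.Icc (j - a) (j - c - 2), symDecomp k 𝔪 j c u
      = ∑ u ∈ Finset.Ico (j - a) (j - 1), ∑ c ∈ Finset.range (j - 1 - u), symDecomp k 𝔪 j c u := by
    refine Finset.sum_comm' fun c u => ?_
    simp only [Finset.mem_range, Finset.mem_Icc, Finset.mem_Ico]
    omega
  rw [hswap]
  have hu : ∀ u, u < j - 1 → ∑ c ∈ Finset.range (j - 1 - u), symDecomp k 𝔪 j c u +
      (Module.finrank k ↥(𝔪 ^ u ⊓ loewy 𝔪 2) + Module.finrank k ↥(𝔪 ^ (u + 1)))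
      = Module.finrank k ↥(𝔪 ^ (u + 1) ⊓ loewy 𝔪 2) + Module.finrank k ↥(𝔪 ^ u) := by
    intro u hu
    have h1 := sum_symDecomp_add_finrank (k := k) 𝔪 j u (j - 1 - u)
    have h2 := finrank_loewyFiltration_add (k := k) 𝔪 j (j - 1 - u) u
    rw [finrank_loewyFiltration_zero 𝔪 hj] at h1
    rw [show j + 1 - (j - 1 - u) - u = 2 by omega] at h2
    have h3 := hilb_add_finrank (k := k) 𝔪 u
    omega
  have hn : ∀ n, j - a ≤ n → n ≤ j - 1 →
      ∑ u ∈ Finset.Ico (j - a) n, ∑ c ∈ Finset.range (j - 1 - u), symDecomp k 𝔪 j c u +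
        (Module.finrank k ↥(𝔪 ^ (j - a) ⊓ loewy 𝔪 2) + Module.finrank k ↥(𝔪 ^ n))
      = Module.finrank k ↥(𝔪 ^ n ⊓ loewy 𝔪 2) + Module.finrank k ↥(𝔪 ^ (j - a)) := by
    intro n hn
    induction n, hn using Nat.le_induction with
    | base => simp
    | succ n hn ih =>
      intro hnj
      rw [Finset.sum_Ico_succ_top hn]
      have h1 := ih (by omega)
      have h2 := hu n (by omega)
      omega
  have h1 := hn (j - 1) (by omega) le_rfl
  have h2 : 𝔪 ^ (j - 1) ⊓ loewy 𝔪 2 = 𝔪 ^ (j - 1) :=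
    inf_eq_left.mpr (pow_le_loewy 𝔪 hj (by omega))
  rw [h2] at h1
  omega

end Filtration

theorem finrank_range_flip {U V : Type*} [AddCommGroup U] [Module k U] [AddCommGroup V]
    [Module k V] [Module.Finite k U] [Module.Finite k V] (B : U →ₗ[k] Module.Dual k V) :
    Module.finrank k (LinearMap.range B.flip) = Module.finrank k (LinearMap.range B) := by
  have h : B.flip = B.dualMap ∘ₗ Module.Dual.eval k V := by
    ext v u
    rfl
  have h1 : LinearMap.range (Module.Dual.eval k V) = ⊤ :=
    LinearMap.range_eq_top.mpr (Module.evalEquiv k V).surjective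
  rw [h, LinearMap.range_comp_of_range_eq_top _ h1,
    LinearMap.finrank_range_dualMap_eq_finrank_range]

/-- For a nondegenerate functional `ε` on a finite-dimensional algebra, multiplication followed by
`ε` pairs `M / (M ∩ (0 : N))` perfectly with `N / (N ∩ (0 : M))`. -/
theorem finrank_add_finrank_inf_annihilator [Module.Finite k A] (ε : A →ₗ[k] k)
    (hε : ∀ x, (∀ y, ε (y * x) = 0) → x = 0) (M N : Ideal A) :
    Module.finrank k M + Module.finrank k ↥(N ⊓ Submodule.annihilator M) =
      Module.finrank k N + Module.finrank k ↥(M ⊓ Submodule.annihilator N) := by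
  let B' : (M.restrictScalars k) →ₗ[k] Module.Dual k (N.restrictScalars k) :=
    ((LinearMap.mul k A).compr₂ ε).domRestrict₁₂ (M.restrictScalars k) (N.restrictScalars k)
  have hker : ∀ (P Q : Ideal A) (C : (P.restrictScalars k) →ₗ[k] Module.Dual k (Q.restrictScalars k)),
      (∀ u v, C u v = ε (u.1 * v.1)) →
      Module.finrank k (LinearMap.ker C) = Module.finrank k ↥(P ⊓ Submodule.annihilator Q) := by
    intro P Q C hC
    have h2 : (LinearMap.ker C).map (P.restrictScalars k).subtype
        = (P ⊓ Submodule.annihilator Q).restrictScalars k := by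
      ext x
      simp only [Submodule.mem_map, LinearMap.mem_ker, Submodule.subtype_apply,
        Submodule.restrictScalars_mem, Submodule.mem_inf, Submodule.mem_annihilator]
      constructor
      · rintro ⟨u, hu, rfl⟩
        refine ⟨u.2, fun v hv => hε _ fun y => ?_⟩
        have h := LinearMap.congr_fun hu ⟨y * v, Q.mul_mem_left y hv⟩
        rw [hC] at h
        rw [smul_eq_mul, mul_left_comm]
        exact h
      · rintro ⟨hx, h⟩
        refine ⟨⟨x, hx⟩, ?_, rfl⟩
        ext v
        rw [hC]
        have := h v.1 v.2
        rw [smul_eq_mul] at this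
        simp [this]
    have h3 := LinearEquiv.finrank_eq ((LinearMap.ker C).equivMapOfInjective
      (P.restrictScalars k).subtype (Submodule.injective_subtype _))
    rw [h3, h2]
    rfl
  have : Module.Finite k (M.restrictScalars k) := FiniteDimensional.finiteDimensional_submodule _
  have : Module.Finite k (N.restrictScalars k) := FiniteDimensional.finiteDimensional_submodule _
  have h1 := LinearMap.finrank_range_add_finrank_ker B'
  have h2 := LinearMap.finrank_range_add_finrank_ker B'.flip
  rw [hker M N B' fun u v => rfl] at h1
  rw [hker N M B'.flip fun u v => congrArg ε (mul_comm _ _), finrank_range_flip] at h2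
  have h3 : Module.finrank k (M.restrictScalars k) = Module.finrank k M := rfl
  have h4 : Module.finrank k (N.restrictScalars k) = Module.finrank k N := rfl
  omega

section Transport

variable {B : Type*} [CommRing B] [Algebra k B] (E : A ≃ₐ[k] B)

theorem finrank_map_algEquiv (I : Ideal A) :
    Module.finrank k (I.map (E : A →+* B)) = Module.finrank k I := by
  have h : (I.restrictScalars k).map (E.toLinearEquiv : A →ₗ[k] B)
      = (I.map (E : A →+* B)).restrictScalars k := by
    ext y
    simp only [Submodule.mem_map, Submodule.restrictScalars_mem]
    rw [Ideal.mem_map_iff_of_surjective (E : A →+* B) E.surjective]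
    rfl
  have h1 := LinearEquiv.finrank_eq (E.toLinearEquiv.submoduleMap (I.restrictScalars k))
  rw [h] at h1
  exact h1.symm

theorem map_loewy_algEquiv (𝔪 : Ideal A) (e : ℕ) :
    (loewy 𝔪 e).map (E : A →+* B) = loewy (𝔪.map (E : A →+* B)) e := by
  ext y
  rw [Ideal.mem_map_iff_of_surjective (E : A →+* B) E.surjective, loewy, loewy,
    Submodule.mem_annihilator, ← Ideal.map_pow]
  simp only [Submodule.mem_annihilator, smul_eq_mul]
  constructor
  · rintro ⟨x, hx, rfl⟩ n hn
    obtain ⟨m, hm, rfl⟩ := (Ideal.mem_map_iff_of_surjective (E : A →+* B) E.surjective).mp hn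
    rw [← map_mul, hx m hm, map_zero]
  · intro h
    refine ⟨E.symm y, fun n hn => E.injective ?_, E.apply_symm_apply y⟩
    rw [map_mul, E.apply_symm_apply, map_zero]
    exact h _ (Ideal.mem_map_of_mem (E : A →+* B) hn)

theorem map_inf_algEquiv (I J : Ideal A) :
    (I ⊓ J).map (E : A →+* B) = I.map (E : A →+* B) ⊓ J.map (E : A →+* B) := by
  have h : ∀ I : Ideal A, I.map (E : A →+* B) = I.comap (E.symm : B →+* A) := fun I =>
    (Ideal.comap_symm (E : A ≃+* B)).symm
  rw [h, h, h, Ideal.comap_inf]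

variable [Module.Finite k A] [Module.Finite k B]

theorem hilb_map_algEquiv (𝔪 : Ideal A) (i : ℕ) :
    hilb k (𝔪.map (E : A →+* B)) i = hilb k 𝔪 i := by
  have h1 := hilb_add_finrank (k := k) 𝔪 i
  have h2 := hilb_add_finrank (k := k) (𝔪.map (E : A →+* B)) i
  rw [← Ideal.map_pow, ← Ideal.map_pow, finrank_map_algEquiv, finrank_map_algEquiv] at h2
  omega

theorem symDecomp_map_algEquiv (𝔪 : Ideal A) (j a i : ℕ) :
    symDecomp k (𝔪.map (E : A →+* B)) j a i = symDecomp k 𝔪 j a i := by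
  have h : ∀ a, Module.finrank k (loewyFiltration (𝔪.map (E : A →+* B)) j a i)
      = Module.finrank k (loewyFiltration 𝔪 j a i) := by
    intro a
    have h1 := finrank_loewyFiltration_add (k := k) 𝔪 j a i
    have h2 := finrank_loewyFiltration_add (k := k) (𝔪.map (E : A →+* B)) j a i
    have h3 : ∀ i e, Module.finrank k ↥(𝔪.map (E : A →+* B) ^ i ⊓ loewy (𝔪.map (E : A →+* B)) e)
        = Module.finrank k ↥(𝔪 ^ i ⊓ loewy 𝔪 e) := fun i e => by
      rw [← Ideal.map_pow, ← map_loewy_algEquiv, ← map_inf_algEquiv, finrank_map_algEquiv]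
    rw [h3] at h2
    rw [h3] at h2
    omega
  have h1 := symDecomp_add_finrank (k := k) 𝔪 j a i
  have h2 := symDecomp_add_finrank (k := k) (𝔪.map (E : A →+* B)) j a i
  rw [h, h] at h2
  omega

end Transport

end Lengths

/-! ### The algebra of a dual generator -/

section DualGenerator

variable {k : Type*} [Field k] (f : DP k)

/-- The injection `R / Ann f → S`, `r ↦ r ∘ f`. -/
noncomputable def quotApply : (PS k ⧸ Ann f) →ₗ[k] DP k :=
  ((Ann f).restrictScalars k).liftQ (contract.flip f) (fun _ hr => hr) ∘ₗ
    (Submodule.Quotient.restrictScalarsEquiv k (Ann f)).symm.toLinearMap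

theorem quotApply_mk (r : PS k) : quotApply f (Ideal.Quotient.mk (Ann f) r) = contract r f := rfl

theorem quotApply_injective : Function.Injective (quotApply f) := by
  rw [← LinearMap.ker_eq_bot, LinearMap.ker_eq_bot']
  intro x hx
  obtain ⟨r, rfl⟩ := Ideal.Quotient.mk_surjective x
  exact Ideal.Quotient.eq_zero_iff_mem.mpr hx

instance finite_quotient_Ann : Module.Finite k (PS k ⧸ Ann f) := by
  have h : LinearMap.range (quotApply f) ≤ LinearMap.range (contract.flip f) := by
    rintro _ ⟨x, rfl⟩
    obtain ⟨r, rfl⟩ := Ideal.Quotient.mk_surjective x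
    exact ⟨r, rfl⟩
  have := Submodule.finiteDimensional_of_le h
  exact Module.Finite.equiv (LinearEquiv.ofInjective _ (quotApply_injective f)).symm

theorem mem_maxQuot_pow_iff (I : Ideal (PS k)) (i : ℕ) (x : PS k ⧸ I) :
    x ∈ maxQuot I ^ i ↔
      ∃ s ∈ IsLocalRing.maximalIdeal (PS k) ^ i, Ideal.Quotient.mk I s = x := by
  rw [maxQuot, ← Ideal.map_pow,
    Ideal.mem_map_iff_of_surjective _ Ideal.Quotient.mk_surjective]

/-- The Loewy ideal `(0 : 𝔪_A^e)` corresponds to the partials of `f` of degree less than `e`. -/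
theorem mem_loewy_maxQuot_iff (e : ℕ) (x : PS k ⧸ Ann f) :
    x ∈ loewy (maxQuot (Ann f)) e ↔ quotApply f x ∈ dpLT k e := by
  obtain ⟨r, rfl⟩ := Ideal.Quotient.mk_surjective x
  rw [quotApply_mk, contract_mem_dpLT_iff, pairing_mul_eq_zero_iff_contract, loewy,
    Submodule.mem_annihilator]
  constructor
  · intro h s hs
    have h1 := h (Ideal.Quotient.mk _ s) ((mem_maxQuot_pow_iff _ _ _).mpr ⟨s, hs, rfl⟩)
    rw [smul_eq_mul, ← map_mul, Ideal.Quotient.eq_zero_iff_mem, mul_comm] at h1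
    exact h1
  · intro h y hy
    obtain ⟨s, hs, rfl⟩ := (mem_maxQuot_pow_iff _ _ _).mp hy
    rw [smul_eq_mul, ← map_mul, Ideal.Quotient.eq_zero_iff_mem, mul_comm]
    exact h s hs

/-- The algebra `R / Ann f` is Gorenstein: the functional `r ↦ ⟨r, f⟩` is nondegenerate. Hence
`dim 𝔪^p - dim (𝔪^p ∩ (0 : 𝔪^q))` is symmetric in `p` and `q`. -/
theorem finrank_maxQuot_pow_add (p q : ℕ) :
    Module.finrank k ↥(maxQuot (Ann f) ^ p) +
        Module.finrank k ↥(maxQuot (Ann f) ^ q ⊓ loewy (maxQuot (Ann f)) p) =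
      Module.finrank k ↥(maxQuot (Ann f) ^ q) +
        Module.finrank k ↥(maxQuot (Ann f) ^ p ⊓ loewy (maxQuot (Ann f)) q) := by
  refine finrank_add_finrank_inf_annihilator (Finsupp.lapply 0 ∘ₗ quotApply f) ?_ _ _
  intro x hx
  obtain ⟨r, rfl⟩ := Ideal.Quotient.mk_surjective x
  rw [Ideal.Quotient.eq_zero_iff_mem, mem_Ann_iff, contract_eq_zero_iff]
  exact fun s => hx (Ideal.Quotient.mk _ s)

theorem mem_GorD_of_map_eq {I J : Ideal (PS k)} [Module.Finite k (PS k ⧸ I)]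
    [Module.Finite k (PS k ⧸ J)] (θ : PS k ≃ₐ[k] PS k) (hIJ : J = I.map (θ : PS k →+* PS k))
    {j : ℕ} {H : ℕ → ℕ} {D : ℕ → ℕ → ℕ} (hJ : J ∈ GorD j H D) : I ∈ GorD j H D := by
  let E : (PS k ⧸ I) ≃ₐ[k] (PS k ⧸ J) := Ideal.quotientEquivAlg I J θ hIJ
  have hE : maxQuot J = (maxQuot I).map (E : (PS k ⧸ I) →+* (PS k ⧸ J)) := by
    have h1 : (IsLocalRing.maximalIdeal (PS k)).map (θ : PS k →+* PS k)
        = IsLocalRing.maximalIdeal (PS k) := by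
      ext r
      rw [Ideal.mem_map_iff_of_surjective (θ : PS k →+* PS k) θ.surjective]
      constructor
      · rintro ⟨s, hs, rfl⟩
        have := algHom_mem_pow_maximalIdeal (θ : PS k →ₐ[k] PS k) (d := 1) (by simpa using hs)
        simpa using this
      · intro hr
        refine ⟨θ.symm r, ?_, θ.apply_symm_apply r⟩
        have := algHom_mem_pow_maximalIdeal (θ.symm : PS k →ₐ[k] PS k) (d := 1)
          (by simpa using hr)
        simpa using this
    rw [maxQuot, maxQuot, Ideal.map_map, ← h1, Ideal.map_map, h1]
    rfl
  obtain ⟨⟨-, h1, h2, h3, h4⟩, h5⟩ := hJ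
  have hpow : ∀ i, maxQuot J ^ i = (maxQuot I ^ i).map (E : (PS k ⧸ I) →+* (PS k ⧸ J)) := by
    intro i
    rw [hE, Ideal.map_pow]
  refine ⟨⟨isArtinian_of_tower k inferInstance, ?_, ?_, ?_, ?_⟩, ?_⟩
  · rw [hE, ← map_loewy_algEquiv, finrank_map_algEquiv] at h1
    exact h1
  · intro h
    rw [hpow, h, Ideal.map_bot] at h2
    exact h2 rfl
  · rw [hpow] at h3
    exact (Ideal.map_eq_bot_iff_of_injective E.injective).mp h3
  · intro i
    rw [← h4, hE, hilb_map_algEquiv]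
  · intro a i
    rw [← h5, hE, symDecomp_map_algEquiv]

theorem Ann_exoticGen_mem_GorD (b : Module.Basis (Fin 3) k (Fin 3 → k)) (φ : orderGE2 k)
    {j : ℕ} {H : ℕ → ℕ} {D : ℕ → ℕ → ℕ} (hf : Ann f ∈ GorD j H D) :
    Ann (exoticGen b f φ) ∈ GorD j H D := by
  refine mem_GorD_of_map_eq (shearEquiv b φ) ?_ hf
  ext r
  rw [Ideal.mem_map_iff_of_surjective (shearEquiv b φ : PS k →+* PS k)
    (shearEquiv b φ).surjective]
  constructor
  · intro hr
    refine ⟨(shearEquiv b φ).symm r, ?_, (shearEquiv b φ).apply_symm_apply r⟩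
    rw [mem_Ann_exoticGen_iff]
    change shearEquiv b φ ((shearEquiv b φ).symm r) ∈ _
    rwa [AlgEquiv.apply_symm_apply]
  · rintro ⟨s, hs, rfl⟩
    exact (mem_Ann_exoticGen_iff b f φ s).mp hs

/-! ### Linear partials and the symmetric decomposition -/

variable {f} {j a : ℕ} {H : ℕ → ℕ} {D : ℕ → ℕ → ℕ}

theorem loewy_one_le_pow (hf : Ann f ∈ GorD j H D) {n : ℕ} (hn : n ≤ j) :
    loewy (maxQuot (Ann f)) 1 ≤ maxQuot (Ann f) ^ n := by
  obtain ⟨⟨-, h1, h2, h3, -⟩, -⟩ := hf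
  have h4 : maxQuot (Ann f) ^ j ≤ loewy (maxQuot (Ann f)) 1 := pow_le_loewy _ h3 le_rfl
  have h5 : 0 < Module.finrank k ↥(maxQuot (Ann f) ^ j) := by
    rw [Module.finrank_pos_iff, Submodule.nontrivial_iff_ne_bot]
    exact h2
  have h6 : (maxQuot (Ann f) ^ j).restrictScalars k = (loewy (maxQuot (Ann f)) 1).restrictScalars k :=
    Submodule.eq_of_le_of_finrank_le h4 (h1.trans_le h5)
  intro x hx
  have h7 : x ∈ (maxQuot (Ann f) ^ j).restrictScalars k := by
    rw [h6]
    exact hx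
  exact Ideal.pow_le_pow_right hn h7

theorem finrank_loewyFiltration_one (hf : Ann f ∈ GorD j H D) (hH : H 1 = 3) (c : ℕ) :
    ∑ i ∈ Finset.range c, D i 1 + Module.finrank k (loewyFiltration (maxQuot (Ann f)) j c 1) = 3 := by
  have h1 := sum_symDecomp_add_finrank (k := k) (maxQuot (Ann f)) j 1 c
  rw [finrank_loewyFiltration_zero _ hf.1.2.2.2.1, hf.1.2.2.2.2, hH] at h1
  simpa only [hf.2] using h1

/-- If `j ≤ a + 1`, then `(0 : 𝔪^(j-a))` is zero or the socle, which lies in `𝔪^2`, so that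
`C(a)_1 = 0`. -/
theorem add_two_le_socleDegree (hf : Ann f ∈ GorD j H D) (hH : H 1 = 3) (ha : 2 ≤ a)
    (hn : ∑ c ∈ Finset.range a, D c 1 = 2) : a + 2 ≤ j := by
  by_contra hlt
  have h1 := finrank_loewyFiltration_one hf hH a
  have h2 := finrank_loewyFiltration_add (k := k) (maxQuot (Ann f)) j a 1
  have hL : loewy (maxQuot (Ann f)) (j + 1 - a - 1) ≤ maxQuot (Ann f) ^ 2 := by
    rcases Nat.lt_or_ge a j with hj | hj
    · rw [show j + 1 - a - 1 = 1 by omega]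
      exact loewy_one_le_pow hf (by omega)
    · rw [show j + 1 - a - 1 = 0 by omega]
      intro x hx
      rw [loewy, Submodule.mem_annihilator] at hx
      have h3 := hx 1 (by simp)
      rw [smul_eq_mul, mul_one] at h3
      rw [h3]
      exact zero_mem _
  rw [inf_eq_right.mpr hL, inf_eq_right.mpr (hL.trans (Ideal.pow_le_pow_right (by omega)))] at h2
  omega

/-- By Gorenstein duality `C(c)_1` determines the dimension of `𝔪^n ∩ (0 : 𝔪^2)`, `n = j - c`. -/
theorem finrank_pow_inf_loewy_two (hf : Ann f ∈ GorD j H D) (hH : H 1 = 3) (c : ℕ) :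
    Module.finrank k ↥(maxQuot (Ann f) ^ (j - c) ⊓ loewy (maxQuot (Ann f)) 2) =
      1 + ∑ i ∈ Finset.range c, D i 1 := by
  have h1 := finrank_loewyFiltration_one hf hH c
  have h2 : Module.finrank k (loewyFiltration (maxQuot (Ann f)) j c 1) +
      Module.finrank k ↥(maxQuot (Ann f) ^ 2 ⊓ loewy (maxQuot (Ann f)) (j + 1 - c - 1)) =
      Module.finrank k ↥(maxQuot (Ann f) ^ 1 ⊓ loewy (maxQuot (Ann f)) (j + 1 - c - 1)) :=
    finrank_loewyFiltration_add (maxQuot (Ann f)) j c 1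
  rw [show j + 1 - c - 1 = j - c by omega] at h2
  have h3 := finrank_maxQuot_pow_add f (j - c) 1
  have h4 := finrank_maxQuot_pow_add f (j - c) 2
  rw [inf_eq_right.mpr (loewy_one_le_pow hf (Nat.sub_le j c)), hf.1.2.1] at h3
  have h5 : hilb k (maxQuot (Ann f)) 1 + Module.finrank k ↥(maxQuot (Ann f) ^ 2) =
      Module.finrank k ↥(maxQuot (Ann f) ^ 1) := hilb_add_finrank (maxQuot (Ann f)) 1
  rw [hf.1.2.2.2.2, hH] at h5
  omega

/-- The coefficient vectors of the linear forms among the partials of `f` of order at least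
`n`. -/
noncomputable def linearPartials (n : ℕ) (f : DP k) : Submodule k (Fin 3 → k) where
  carrier := {c | linForm c ∈ partials n f}
  add_mem' {c d} hc hd := by
    have : linForm (c + d) = linForm c + linForm d := by
      simp [linForm, Finset.sum_add_distrib]
    simp only [Set.mem_ofPred_eq] at *
    rw [this]
    exact add_mem hc hd
  zero_mem' := by simp [linForm]
  smul_mem' r c hc := by
    have : linForm (r • c) = r • linForm c := by
      simp [linForm, Finset.smul_sum]
    simp only [Set.mem_ofPred_eq] at *
    rw [this]
    exact Submodule.smul_mem _ r hc

theorem mem_linearPartials (n : ℕ) (f : DP k) (c : Fin 3 → k) :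
    c ∈ linearPartials n f ↔ linForm c ∈ partials n f := Iff.rfl

theorem linForm_apply (c : Fin 3 → k) (m : Fin 3 →₀ ℕ) :
    linForm c m = ∑ t, if Finsupp.single t 1 = m then c t else 0 := by
  simp [linForm, Finsupp.finsetSum_apply, Finsupp.single_apply]

theorem eq_single_add_linForm {u : DP k} (hu : u ∈ dpLT k 2) :
    u = Finsupp.single 0 (u 0) + linForm fun t => u (Finsupp.single t 1) := by
  classical
  rw [mem_dpLT_iff_apply] at hu
  ext m
  rw [Finsupp.add_apply, linForm_apply]
  by_cases h0 : m = 0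
  · subst h0
    simp
  by_cases h1 : m.degree = 1
  · obtain ⟨t, rfl⟩ : m ∈ Set.range fun t : Fin 3 => Finsupp.single t 1 := by
      rw [Finsupp.range_single_one]
      exact h1
    simp [Finsupp.single_left_inj]
  · have h2 : m.degree ≠ 0 := fun h => h0 ((Finsupp.degree_eq_zero_iff m).mp h)
    rw [hu m (by omega), Finsupp.single_apply, if_neg (Ne.symm h0), zero_add]
    symm
    refine Finset.sum_eq_zero fun t _ => if_neg ?_
    rintro rfl
    simp at h1

theorem single_zero_mem_partials (hf : Ann f ∈ GorD j H D) {n : ℕ} (hn : n ≤ j) :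
    Finsupp.single 0 1 ∈ partials n f := by
  obtain ⟨x, hx, hx0⟩ := Submodule.exists_mem_ne_zero_of_ne_bot hf.1.2.2.1
  have h1 : x ∈ loewy (maxQuot (Ann f)) 1 := pow_le_loewy _ hf.1.2.2.2.1 le_rfl hx
  rw [mem_loewy_maxQuot_iff, mem_dpLT_iff_apply] at h1
  obtain ⟨r, hr, rfl⟩ := (mem_maxQuot_pow_iff _ _ _).mp hx
  rw [quotApply_mk] at h1
  have h2 : contract r f = Finsupp.single 0 (contract r f 0) := by
    ext m
    by_cases hm : m = 0
    · simp [hm]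
    · rw [h1 m, Finsupp.single_apply, if_neg (Ne.symm hm)]
      rw [Nat.one_le_iff_ne_zero]
      exact fun h => hm ((Finsupp.degree_eq_zero_iff m).mp h)
  have h3 : contract r f 0 ≠ 0 := by
    intro h
    rw [h, Finsupp.single_zero] at h2
    exact hx0 (Ideal.Quotient.eq_zero_iff_mem.mpr h2)
  have h4 : contract r f ∈ partials n f :=
    (mem_partials_iff _ _ _).mpr ⟨r, Ideal.pow_le_pow_right hn hr, rfl⟩
  have h5 := Submodule.smul_mem _ (contract r f 0)⁻¹ h4
  rw [h2, Finsupp.smul_single, smul_eq_mul] at h5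
  simpa [h3] using h5

/-- The partials of order at least `n` and degree at most `1` are spanned by the constant `1` and
the linear forms among them. -/
theorem finrank_linearPartials_add_one (hf : Ann f ∈ GorD j H D) {n : ℕ} (hn : n ≤ j) :
    Module.finrank k (linearPartials n f) + 1 =
      Module.finrank k ↥(maxQuot (Ann f) ^ n ⊓ loewy (maxQuot (Ann f)) 2) := by
  classical
  let P : Submodule k (PS k ⧸ Ann f) :=
    (maxQuot (Ann f) ^ n ⊓ loewy (maxQuot (Ann f)) 2).restrictScalars k
  let lin : DP k →ₗ[k] (Fin 3 → k) :=
    LinearMap.pi fun t => Finsupp.lapply (Finsupp.single t 1)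
  have hlin : ∀ u t, lin u t = u (Finsupp.single t 1) := fun _ _ => rfl
  have hP : ∀ u, u ∈ P.map (quotApply f) ↔ u ∈ partials n f ∧ u ∈ dpLT k 2 := by
    intro u
    rw [Submodule.mem_map]
    constructor
    · rintro ⟨x, hx, rfl⟩
      obtain ⟨r, hr, rfl⟩ := (mem_maxQuot_pow_iff _ _ _).mp hx.1
      exact ⟨(mem_partials_iff _ _ _).mpr ⟨r, hr, rfl⟩, (mem_loewy_maxQuot_iff _ _ _).mp hx.2⟩
    · rintro ⟨h1, h2⟩
      obtain ⟨r, hr, rfl⟩ := (mem_partials_iff _ _ _).mp h1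
      exact ⟨Ideal.Quotient.mk _ r, ⟨(mem_maxQuot_pow_iff _ _ _).mpr ⟨r, hr, rfl⟩,
        (mem_loewy_maxQuot_iff _ _ _).mpr h2⟩, rfl⟩
  have hone := single_zero_mem_partials hf hn
  have h1 := finrank_map_add_finrank_inf_ker (k := k) (lin ∘ₗ quotApply f) P
  have h2 : P.map (lin ∘ₗ quotApply f) = linearPartials n f := by
    rw [Submodule.map_comp]
    ext c
    rw [Submodule.mem_map, mem_linearPartials]
    constructor
    · rintro ⟨u, hu, rfl⟩
      obtain ⟨hu1, hu2⟩ := (hP u).mp hu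
      have h3 := eq_single_add_linForm hu2
      have h4 : linForm (lin u) = u - u 0 • Finsupp.single 0 1 := by
        rw [eq_sub_iff_add_eq, Finsupp.smul_single, smul_eq_mul, mul_one, add_comm]
        exact h3.symm
      rw [h4]
      exact sub_mem hu1 (Submodule.smul_mem _ _ hone)
    · intro hc
      refine ⟨linForm c, (hP _).mpr ⟨hc, ?_⟩, ?_⟩
      · rw [mem_dpLT_iff_apply]
        intro m hm
        rw [linForm_apply]
        refine Finset.sum_eq_zero fun t _ => if_neg ?_
        rintro rfl
        simp at hm
      · ext t
        rw [hlin, linForm_apply]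
        simp [Finsupp.single_left_inj]
  have h3 : (P ⊓ LinearMap.ker (lin ∘ₗ quotApply f)).map (quotApply f)
      = k ∙ (Finsupp.single 0 1 : DP k) := by
    ext u
    rw [Submodule.mem_span_singleton]
    constructor
    · rintro ⟨x, ⟨hx1, hx2⟩, rfl⟩
      have h4 := eq_single_add_linForm ((hP _).mp ⟨x, hx1, rfl⟩).2
      have h5 : (fun t => quotApply f x (Finsupp.single t 1)) = 0 := hx2
      refine ⟨quotApply f x 0, ?_⟩
      rw [h5] at h4
      rw [Finsupp.smul_single, smul_eq_mul, mul_one]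
      conv_rhs => rw [h4]
      simp [linForm]
    · rintro ⟨c, rfl⟩
      have h4 : (c • Finsupp.single 0 1 : DP k) ∈ P.map (quotApply f) := by
        refine (hP _).mpr ⟨Submodule.smul_mem _ _ hone, ?_⟩
        rw [mem_dpLT_iff_apply]
        intro m hm
        have : (0 : Fin 3 →₀ ℕ) ≠ m := by
          rintro rfl
          simp at hm
        simp [this]
      obtain ⟨x, hx, hxc⟩ := h4
      refine ⟨x, ⟨hx, ?_⟩, hxc⟩
      change lin (quotApply f x) = 0
      rw [hxc]
      ext t
      rw [hlin]
      simp
  have h4 := LinearEquiv.finrank_eq ((P ⊓ LinearMap.ker (lin ∘ₗ quotApply f)).equivMapOfInjective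
    (quotApply f) (quotApply_injective f))
  rw [h3, finrank_span_singleton (by simp)] at h4
  rw [h2, h4] at h1
  exact h1

end DualGenerator

/-! ### Adapted coordinates -/

section Adapted

variable {k : Type*} [Field k] {f : DP k} {j a : ℕ} {H : ℕ → ℕ} {D : ℕ → ℕ → ℕ}

theorem exists_basis_of_finrank_eq_two {U : Submodule k (Fin 3 → k)}
    (hU : Module.finrank k U = 2) :
    ∃ b : Module.Basis (Fin 3) k (Fin 3 → k), b 0 ∈ U ∧ b 1 ∈ U ∧ b 2 ∉ U := by
  let u := Module.finBasisOfFinrankEq k U hU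
  have hne : U ≠ ⊤ := by
    intro h
    rw [h, finrank_top, Module.finrank_fin_fun] at hU
    omega
  obtain ⟨v, hv⟩ : ∃ v, v ∉ U := by
    by_contra! h
    exact hne ((Submodule.eq_top_iff').mpr h)
  have hspan : Submodule.span k (Set.range (U.subtype ∘ u)) = U := by
    rw [Set.range_comp, ← Submodule.map_span, u.span_eq, Submodule.map_top, Submodule.range_subtype]
  have hli : LinearIndependent k (Fin.snoc (U.subtype ∘ u) v : Fin (2 + 1) → Fin 3 → k) := by
    rw [linearIndependent_finSnoc, hspan]
    exact ⟨u.linearIndependent.map' _ (Submodule.ker_subtype _), hv⟩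
  let b : Module.Basis (Fin 3) k (Fin 3 → k) :=
    basisOfLinearIndependentOfCardEqFinrank hli (by simp)
  have hb : ∀ i, b i = (Fin.snoc (U.subtype ∘ u) v : Fin (2 + 1) → Fin 3 → k) i := fun i =>
    congrFun (coe_basisOfLinearIndependentOfCardEqFinrank hli (by simp)) i
  refine ⟨b, ?_, ?_, ?_⟩
  · rw [hb]
    exact (u 0).2
  · rw [hb]
    exact (u 1).2
  · rw [hb]
    exact hv

/-- Among the partials of order at least `j-a` the linear forms have dimension `2`; among those of
order at least `j-a-1` there are all linear forms. -/
theorem exists_isAdapted (hf : Ann f ∈ GorD j H D) (hH : H 1 = 3) (ha : 2 ≤ a)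
    (hn : ∑ c ∈ Finset.range a, D c 1 = 2) (hn' : ∑ c ∈ Finset.range (a + 1), D c 1 = 3) :
    ∃ b : Module.Basis (Fin 3) k (Fin 3 → k), IsAdapted b (j - a) f := by
  have haj := add_two_le_socleDegree hf hH ha hn
  have h1 : Module.finrank k (linearPartials (j - a) f) = 2 := by
    have h := finrank_linearPartials_add_one hf (Nat.sub_le j a)
    rw [finrank_pow_inf_loewy_two hf hH, hn] at h
    omega
  have h2 : linearPartials (j - a - 1) f = ⊤ := by
    apply Submodule.eq_top_of_finrank_eq
    have h := finrank_linearPartials_add_one hf (Nat.sub_le j (a + 1))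
    rw [finrank_pow_inf_loewy_two hf hH, hn'] at h
    rw [Module.finrank_fin_fun, show j - a - 1 = j - (a + 1) by omega]
    omega
  obtain ⟨b, h3, h4, h5⟩ := exists_basis_of_finrank_eq_two h1
  refine ⟨b, h3, h4, ?_, h5⟩
  rw [← mem_linearPartials, h2]
  trivial

/-- A partial of order at least `e` and degree at most `1` does not involve `Z`. -/
theorem pairing_dualForm_eq_zero {b : Module.Basis (Fin 3) k (Fin 3 → k)} {e : ℕ}
    (hb : IsAdapted b e f) {w : DP k} (hw : w ∈ partials e f) (hw2 : w ∈ dpLT k 2) :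
    pairing (dualForm b 2) w = 0 := by
  obtain ⟨h0, h1, -, h2⟩ := hb
  have hone : (Finsupp.single 0 1 : DP k) ∈ partials e f := by
    have h3 : contract (dualForm b 0) (linForm (b 0)) = Finsupp.single 0 1 := by
      ext n
      by_cases hn : n = 0
      · subst hn
        rw [← pairing_apply, pairing_dualForm_linForm]
        simp
      · rw [contract_apply, pairing_linForm, Finsupp.single_apply, if_neg (Ne.symm hn)]
        refine Finset.sum_eq_zero fun t _ => ?_
        have h4 : MvPowerSeries.monomial n 1 * dualForm b 0 ∈
            IsLocalRing.maximalIdeal (PS k) ^ (n.degree + 1) := by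
          rw [pow_succ]
          exact Ideal.mul_mem_mul (monomial_mem_pow_maximalIdeal n 1)
            (dualForm_mem_maximalIdeal b 0)
        have h5 : n.degree ≠ 0 := fun h => hn ((Finsupp.degree_eq_zero_iff n).mp h)
        rw [(mem_pow_maximalIdeal_iff _ _).mp h4 _ (by rw [Finsupp.degree_single]; omega), mul_zero]
    rw [← h3]
    exact contract_mem_partials _ h0
  have hw3 := eq_single_add_linForm hw2
  set c : Fin 3 → k := fun t => w (Finsupp.single t 1) with hc
  have hcp : c ∈ linearPartials e f := by
    have h4 : linForm c = w - w 0 • Finsupp.single 0 1 := by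
      rw [eq_sub_iff_add_eq, Finsupp.smul_single, smul_eq_mul, mul_one, add_comm]
      exact hw3.symm
    rw [mem_linearPartials, h4]
    exact sub_mem hw (Submodule.smul_mem _ _ hone)
  have hz : pairing (dualForm b 2) w = b.coord 2 c := by
    rw [hw3, map_add, pairing_dualForm_linForm, pairing_single,
      MvPowerSeries.coeff_zero_eq_constantCoeff_apply,
      (mem_maximalIdeal_iff_constantCoeff _).mp (dualForm_mem_maximalIdeal b 2), mul_zero, zero_add]
  rw [hz]
  by_contra hne
  apply h2
  rw [← mem_linearPartials]
  have hsum := b.sum_repr c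
  rw [Fin.sum_univ_three] at hsum
  have h5 : b.coord 2 c • b 2 = c - (b.repr c 0 • b 0 + b.repr c 1 • b 1) := by
    rw [eq_sub_iff_add_eq, add_comm]
    exact hsum
  have h6 : b.coord 2 c • b 2 ∈ linearPartials e f := by
    rw [h5]
    exact sub_mem hcp (add_mem (Submodule.smul_mem _ _ h0) (Submodule.smul_mem _ _ h1))
  have h7 := Submodule.smul_mem _ (b.coord 2 c)⁻¹ h6
  rwa [smul_smul, inv_mul_cancel₀ hne, one_smul] at h7

/-- The top-degree form of a partial of order at least `e` does not involve `Z`, since its linear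
partials do not. So a partial of order at least `e` that is orthogonal to `k{x, y}_{≥ 2}` has degree
at most `1`. -/
theorem mem_dpLT_two_of_pairing_eq_zero {b : Module.Basis (Fin 3) k (Fin 3 → k)} {e : ℕ}
    (hb : IsAdapted b e f) {w : DP k} (hw : w ∈ partials e f)
    (h : ∀ φ ∈ orderGE2 k, pairing (coordSeries b φ) w = 0) : w ∈ dpLT k 2 := by
  -- Modulo `k{x, y}_{≥ 2}` an element of `𝔪^(2+d)` is `z s` with `s ∈ 𝔪^(1+d)`, and `s ∘ w` has
  -- degree at most `1`.
  have hstep : ∀ d, w ∈ dpLT k (2 + d + 1) → w ∈ dpLT k (2 + d) := by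
    intro d hd
    rw [mem_dpLT_iff] at hd ⊢
    intro r hr
    obtain ⟨φ, hφ, s, hs, hN⟩ := exists_coordSeries_add_mul_sub_mem_pow b (dpDeg w + 1) _ r hr
    have h1 := pairing_eq_zero_of_mem_pow (Nat.lt_succ_self _) hN
    rw [map_sub, LinearMap.sub_apply, sub_eq_zero] at h1
    rw [h1, map_add, LinearMap.add_apply,
      h φ ((mem_orderGE2_iff φ).mpr (Ideal.pow_le_pow_right (by omega) hφ)), zero_add, pairing_mul]
    refine pairing_dualForm_eq_zero hb (contract_mem_partials s hw) ?_
    rw [contract_mem_dpLT_iff]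
    intro t ht
    refine hd _ ?_
    have h2 := Ideal.mul_mem_mul ht hs
    rw [← pow_add] at h2
    exact Ideal.pow_le_pow_right (by omega) h2
  have hall : ∀ d, w ∈ dpLT k (2 + d) → w ∈ dpLT k 2 := by
    intro d
    induction d with
    | zero => exact id
    | succ d ih => exact fun hd => ih (hstep d hd)
  exact hall (dpDeg w + 1) (dpLT_mono (by omega) (mem_dpLT_dpDeg_succ w))

/-- In adapted coordinates `z` agrees on `𝔪^e ∘ f` with a series `φ` in `x, y` of order at least
`2`, that is, `z - φ` kills `𝔪^e ∘ f`. -/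
theorem exists_contract_sub_mem_dpLT {b : Module.Basis (Fin 3) k (Fin 3 → k)} {e : ℕ}
    (hb : IsAdapted b e f) :
    ∃ φ : orderGE2 k, contract (dualForm b 2 - coordSeries b φ) f ∈ dpLT k e := by
  obtain ⟨p, ⟨φ, hφ, rfl⟩, hp⟩ := exists_pairing_eq_on (partials e f)
    ((orderGE2 k).map (coordSeries b).toLinearMap) (dualForm b 2) fun w hw h =>
      pairing_dualForm_eq_zero hb hw
        (mem_dpLT_two_of_pairing_eq_zero hb hw fun φ hφ => h _ ⟨φ, hφ, rfl⟩)
  refine ⟨⟨φ, hφ⟩, ?_⟩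
  rw [contract_mem_dpLT_iff]
  intro s hs
  rw [mul_comm, pairing_mul, map_sub, LinearMap.sub_apply, sub_eq_zero]
  exact hp _ ((mem_partials_iff _ _ _).mpr ⟨s, hs, rfl⟩)

theorem contract_exoticGen_mem_dpLT_iff (b : Module.Basis (Fin 3) k (Fin 3 → k)) (e : ℕ)
    (F : DP k) (φ : orderGE2 k) (r : PS k) :
    contract r (exoticGen b F φ) ∈ dpLT k e ↔ contract (shear b φ r) F ∈ dpLT k e := by
  simp only [contract_mem_dpLT_iff, pairing_exoticGen, map_mul]
  constructor
  · intro h s hs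
    have := h _ (shear_mem_pow b (φ := -φ) hs)
    rwa [shear_shear_neg] at this
  · exact fun h s hs => h _ (shear_mem_pow b hs)

/-- The standard element is obtained from `f` by the inverse of the automorphism `z ↦ z + φ`, where
`z - φ` kills `𝔪^e ∘ f`. If `φ(f_st)` has degree less than `e`, then `f` is itself standard. -/
theorem exists_isStandard_add_exoticPart {b : Module.Basis (Fin 3) k (Fin 3 → k)} {e : ℕ}
    (hb : IsAdapted b e f) (hf : Ann f ∈ GorD j H D) :
    ∃ (fst : DP k) (φ : orderGE2 k), IsStandard b e fst ∧ Ann fst ∈ GorD j H D ∧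
      f = fst + exoticPart b φ fst ∧ (φ = 0 ∨ e ≤ dpDeg (act b φ fst)) := by
  obtain ⟨φ, hφ⟩ := exists_contract_sub_mem_dpLT hb
  have hgen : exoticGen b (exoticGen b f (-φ)) φ = f := exoticGen_neg_exoticGen b f φ
  have hst : contract (dualForm b 2) (exoticGen b f (-φ)) ∈ dpLT k e := by
    rw [contract_exoticGen_mem_dpLT_iff, shear_dualForm_two]
    simpa [sub_eq_add_neg] using hφ
  by_cases hdeg : e ≤ dpDeg (act b φ (exoticGen b f (-φ)))
  · exact ⟨exoticGen b f (-φ), φ, (isStandard_iff b e _).mpr hst,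
      Ann_exoticGen_mem_GorD f b (-φ) hf, hgen.symm, Or.inr hdeg⟩
  · refine ⟨f, 0, (isStandard_iff b e f).mpr ?_, hf, ?_, Or.inl rfl⟩
    · have h := (contract_exoticGen_mem_dpLT_iff b e (exoticGen b f (-φ)) φ (dualForm b 2)).mpr (by
        rw [shear_dualForm_two, map_add, LinearMap.add_apply]
        exact add_mem hst (dpLT_mono (Nat.lt_of_not_le hdeg)
          (mem_dpLT_dpDeg_succ (act b φ (exoticGen b f (-φ))))))
      rwa [hgen] at h
    · rw [ZeroMemClass.coe_zero, exoticPart_zero, add_zero]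

end Adapted

/-! ### The space of exotic parameters -/

section Exotic

variable {k : Type*} [Field k] (b : Module.Basis (Fin 3) k (Fin 3 → k)) {F : DP k} {e : ℕ}

theorem exoticClass_eq_iff (φ ψ : orderGE2 k) :
    exoticClass b e F φ = exoticClass b e F ψ ↔
      contract (coordSeries b φ - coordSeries b ψ) F ∈ dpLT k e := by
  rw [map_sub, LinearMap.sub_apply]
  exact Submodule.Quotient.eq (dpLT k e)

/-- After the automorphism `z ↦ z + φ` the condition reads `𝔪^e (z + φ - ψ) ∘ F = 0`, where
`𝔪^e z ∘ F = 0`. -/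
theorem forall_mul_sub_mem_Ann_iff (hF : IsStandard b e F) (φ ψ : orderGE2 k) :
    (∀ r ∈ IsLocalRing.maximalIdeal (PS k) ^ e,
      r * (dualForm b 2 - coordSeries b ψ) ∈ Ann (exoticGen b F φ)) ↔
      exoticClass b e F ψ = exoticClass b e F φ := by
  rw [isStandard_iff] at hF
  simp only [mem_Ann_iff]
  have h : contract (dualForm b 2 + coordSeries b φ - coordSeries b ψ) F
      = contract (dualForm b 2) F - contract (coordSeries b ψ - coordSeries b φ) F := by
    simp only [map_sub, map_add, LinearMap.sub_apply, LinearMap.add_apply]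
    abel
  rw [← pairing_mul_eq_zero_iff_contract, ← contract_mem_dpLT_iff,
    contract_exoticGen_mem_dpLT_iff, map_sub, shear_dualForm_two, shear_coordSeries,
    exoticClass_eq_iff, h]
  exact ⟨fun h1 => by simpa using sub_mem hF h1, fun h1 => sub_mem hF h1⟩

theorem shear_sub_shear_mul_mem {φ ψ : orderGE2 k} {d d' : ℕ} {r r' : PS k}
    (hr : r ∈ IsLocalRing.maximalIdeal (PS k) ^ d) (hr' : r' ∈ IsLocalRing.maximalIdeal (PS k) ^ d')
    (h : shear b φ r - shear b ψ r ∈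
      Ideal.span {coordSeries b φ - coordSeries b ψ} * IsLocalRing.maximalIdeal (PS k) ^ (d - 1))
    (h' : shear b φ r' - shear b ψ r' ∈
      Ideal.span {coordSeries b φ - coordSeries b ψ} * IsLocalRing.maximalIdeal (PS k) ^ (d' - 1)) :
    shear b φ (r * r') - shear b ψ (r * r') ∈
      Ideal.span {coordSeries b φ - coordSeries b ψ} *
        IsLocalRing.maximalIdeal (PS k) ^ (d + d' - 1) := by
  have h1 : shear b φ (r * r') - shear b ψ (r * r')
      = (shear b φ r - shear b ψ r) * shear b φ r'
        + (shear b φ r' - shear b ψ r') * shear b ψ r := by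
    rw [map_mul, map_mul]
    ring
  rw [h1]
  refine add_mem ?_ ?_
  · have h2 := Ideal.mul_mem_mul h (shear_mem_pow b (φ := φ) hr')
    rw [mul_assoc, ← pow_add] at h2
    exact Ideal.mul_mono_right (Ideal.pow_le_pow_right (by omega)) h2
  · have h2 := Ideal.mul_mem_mul h' (shear_mem_pow b (φ := ψ) hr)
    rw [mul_assoc, ← pow_add] at h2
    exact Ideal.mul_mono_right (Ideal.pow_le_pow_right (by omega)) h2

/-- The automorphisms given by `φ` and `ψ` agree modulo `φ - ψ`; on a monomial of degree `d` the
difference is a multiple of `φ - ψ` by an element of order at least `d - 1`. -/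
theorem shear_sub_shear_monomial_mem (φ ψ : orderGE2 k) (n : Fin 3 →₀ ℕ) :
    shear b φ (MvPowerSeries.monomial n 1) - shear b ψ (MvPowerSeries.monomial n 1) ∈
      Ideal.span {coordSeries b φ - coordSeries b ψ} *
        IsLocalRing.maximalIdeal (PS k) ^ (n.degree - 1) := by
  induction n using Finsupp.induction_linear with
  | zero => simp [MvPowerSeries.monomial_zero_one]
  | add p q hp hq =>
    have h : (MvPowerSeries.monomial (p + q) 1 : PS k)
        = MvPowerSeries.monomial p 1 * MvPowerSeries.monomial q 1 := by
      rw [MvPowerSeries.monomial_mul_monomial, mul_one]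
    rw [h, map_add]
    exact shear_sub_shear_mul_mem b (monomial_mem_pow_maximalIdeal p 1)
      (monomial_mem_pow_maximalIdeal q 1) hp hq
  | single t m =>
    rw [← MvPowerSeries.X_pow_eq, Finsupp.degree_single]
    induction m with
    | zero => simp
    | succ m ih =>
      rw [pow_succ]
      refine shear_sub_shear_mul_mem b (Ideal.pow_mem_pow (X_mem_maximalIdeal t) m)
        (by simpa using X_mem_maximalIdeal t) ih ?_
      rw [shear_X, shear_X, add_sub_add_left_eq_sub, ← smul_sub, Nat.sub_self, pow_zero,
        Ideal.one_eq_top, Ideal.mul_top, Algebra.smul_def]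
      exact Ideal.mul_mem_left _ _ (Ideal.mem_span_singleton_self _)

/-- The elements `f_φ` and `f_ψ` agree in degrees greater than `e` if and only if `φ` and `ψ` have
the same class: one direction tests the difference on `𝔪^(e+1)` through
`shear_sub_shear_monomial_mem`, the other only on the multiples of `z` by series in `x, y`. -/
theorem exoticGen_sub_mem_dpLT_iff (hF : IsStandard b e F) (φ ψ : orderGE2 k) :
    exoticGen b F φ - exoticGen b F ψ ∈ dpLT k (e + 1) ↔
      exoticClass b e F φ = exoticClass b e F ψ := by
  rw [isStandard_iff] at hF
  rw [exoticClass_eq_iff]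
  constructor
  · intro h
    rw [mem_dpLT_iff] at h
    rw [contract_mem_dpLT_iff]
    intro s hs
    obtain ⟨χ, hχ, t, ht, hN⟩ := exists_coordSeries_add_mul_sub_mem_pow b (dpDeg F + 1) e s hs
    have hz := dualForm_mem_maximalIdeal b 2
    have h1 := pairing_eq_zero_of_mem_pow (F := F) (Nat.lt_succ_self _)
      (Ideal.mul_mem_right (coordSeries b φ - coordSeries b ψ) _ hN)
    rw [sub_mul, map_sub, LinearMap.sub_apply, sub_eq_zero] at h1
    rw [h1, add_mul, map_add, LinearMap.add_apply]
    -- Pairing with `z χ(x, y)` isolates the term `Z (φ - ψ)(F)` of the difference.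
    have h2 : pairing (coordSeries b χ * (coordSeries b φ - coordSeries b ψ)) F = 0 := by
      have h3 := h (dualForm b 2 * coordSeries b χ) (by
        rw [pow_succ']
        exact Ideal.mul_mem_mul hz (algHom_mem_pow_maximalIdeal _ hχ))
      rw [map_sub, pairing_exoticGen, pairing_exoticGen, ← LinearMap.sub_apply, ← map_sub, map_mul,
        map_mul, shear_dualForm_two, shear_dualForm_two, shear_coordSeries, shear_coordSeries] at h3
      rw [← h3]
      congr 2
      ring
    rw [h2, zero_add, mul_assoc, mul_comm (dualForm b 2), pairing_mul]
    refine (mem_dpLT_iff e _).mp hF _ ?_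
    have h4 := Ideal.mul_mem_mul ht
      (sub_mem (coordSeries_mem_sq b φ) (coordSeries_mem_sq b ψ))
    rw [← pow_add] at h4
    exact Ideal.pow_le_pow_right (show e ≤ e - 1 + 2 by omega) h4
  · intro h
    rw [contract_mem_dpLT_iff] at h
    rw [mem_dpLT_iff_apply]
    intro n hn
    rw [← pairing_monomial, map_sub, pairing_exoticGen, pairing_exoticGen, ← LinearMap.sub_apply,
      ← map_sub]
    obtain ⟨s, hs, hs'⟩ := Ideal.mem_span_singleton_mul.mp (shear_sub_shear_monomial_mem b φ ψ n)
    rw [← hs', mul_comm]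
    exact h s (Ideal.pow_le_pow_right (show e ≤ n.degree - 1 by omega) hs)

/-- The space `V` is the image of `𝔪_A^2` in `S / S_{<e}`, since `z ∘ F` has degree less than
`e`. -/
theorem exoticSpace_eq_map (hF : IsStandard b e F) :
    ExoticSpace b e F = ((maxQuot (Ann F) ^ 2).restrictScalars k).map
      ((dpLT k e).mkQ ∘ₗ quotApply F) := by
  rw [isStandard_iff] at hF
  ext v
  rw [LinearMap.mem_range, Submodule.mem_map]
  constructor
  · rintro ⟨φ, rfl⟩
    exact ⟨Ideal.Quotient.mk _ (coordSeries b φ),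
      (mem_maxQuot_pow_iff _ _ _).mpr ⟨_, coordSeries_mem_sq b φ, rfl⟩, rfl⟩
  · rintro ⟨x, hx, rfl⟩
    obtain ⟨r, hr, rfl⟩ := (mem_maxQuot_pow_iff _ _ _).mp hx
    obtain ⟨φ, hφ, s, -, hN⟩ := exists_coordSeries_add_mul_sub_mem_pow b (dpDeg F + 1) 2 r hr
    refine ⟨⟨φ, (mem_orderGE2_iff φ).mpr hφ⟩, ?_⟩
    symm
    refine (Submodule.Quotient.eq (dpLT k e)).mpr ?_
    change contract r F - contract (coordSeries b φ) F ∈ dpLT k e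
    have h1 := contract_eq_zero_of_mem_pow (F := F) (Nat.lt_succ_self _) hN
    rw [map_sub, LinearMap.sub_apply, sub_eq_zero] at h1
    rw [h1, map_add, LinearMap.add_apply, add_sub_cancel_left, contract_mem_dpLT_iff]
    intro t ht
    rw [mul_comm (dualForm b 2), ← mul_assoc, pairing_mul]
    exact (mem_dpLT_iff _ _).mp hF _ (Ideal.mul_mem_right s _ ht)

theorem finite_exoticSpace (hF : IsStandard b e F) : Module.Finite k (ExoticSpace b e F) := by
  rw [exoticSpace_eq_map b hF]
  have : Module.Finite k ((maxQuot (Ann F) ^ 2).restrictScalars k) :=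
    FiniteDimensional.finiteDimensional_submodule _
  exact Module.Finite.map _ _

/-- As `V ≅ 𝔪_A^2 / (𝔪_A^2 ∩ (0 : 𝔪_A^e))`, Gorenstein duality computes its dimension from the dual
space `𝔪_A^e / (𝔪_A^e ∩ (0 : 𝔪_A^2))`. -/
theorem finrank_exoticSpace {j a : ℕ} {H : ℕ → ℕ} {D : ℕ → ℕ → ℕ} (ha : 1 ≤ a) (haj : a + 2 ≤ j)
    (hF : IsStandard b (j - a) F) (hG : Ann F ∈ GorD j H D) :
    Module.finrank k (ExoticSpace b (j - a) F) =
      ∑ c ∈ Finset.range a, ∑ u ∈ Finset.Icc (j - a) (j - c - 2), D c u := by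
  have h1 := finrank_map_add_finrank_inf_ker (k := k) ((dpLT k (j - a)).mkQ ∘ₗ quotApply F)
    ((maxQuot (Ann F) ^ 2).restrictScalars k)
  have h2 : (maxQuot (Ann F) ^ 2).restrictScalars k ⊓
      LinearMap.ker ((dpLT k (j - a)).mkQ ∘ₗ quotApply F)
      = (maxQuot (Ann F) ^ 2 ⊓ loewy (maxQuot (Ann F)) (j - a)).restrictScalars k := by
    ext x
    rw [Submodule.mem_inf, LinearMap.mem_ker, LinearMap.comp_apply, Submodule.mkQ_apply,
      Submodule.Quotient.mk_eq_zero, ← mem_loewy_maxQuot_iff]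
    rfl
  rw [h2, ← exoticSpace_eq_map b hF] at h1
  have h3 : Module.finrank k (ExoticSpace b (j - a) F) +
      Module.finrank k ↥(maxQuot (Ann F) ^ 2 ⊓ loewy (maxQuot (Ann F)) (j - a)) =
      Module.finrank k ↥(maxQuot (Ann F) ^ 2) := h1
  have h4 := finrank_maxQuot_pow_add F 2 (j - a)
  have h5 := sum_sum_symDecomp_add_finrank (k := k) (maxQuot (Ann F)) ha haj hG.1.2.2.2.1
  simp only [hG.2] at h5
  omega

end Exotic

end GorensteinDual

theorem mainTheorem10 {k : Type*} [Field k] [Infinite k]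
    (j a : ℕ) (H : ℕ → ℕ) (D : ℕ → ℕ → ℕ) (hH : H 1 = 3) (ha : 2 ≤ a)
    (hn : ∑ c ∈ Finset.range a, D c 1 = 2) (hn' : ∑ c ∈ Finset.range (a + 1), D c 1 = 3) :
    -- existence of adapted coordinates and of the decomposition `f = f_st + f_ex`
    (∀ f : DP k, Ann f ∈ GorD j H D →
      (∃ b : Module.Basis (Fin 3) k (Fin 3 → k), IsAdapted b (j - a) f) ∧
      ∀ b : Module.Basis (Fin 3) k (Fin 3 → k), IsAdapted b (j - a) f →
        ∃ (fst : DP k) (φ : orderGE2 k),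
          IsStandard b (j - a) fst ∧ Ann fst ∈ GorD j H D ∧
          f = fst + exoticPart b φ fst ∧
          (φ = 0 ∨ j - a ≤ dpDeg (act b φ fst))) ∧
    -- the algebras with given `f_st`
    (∀ (b : Module.Basis (Fin 3) k (Fin 3 → k)) (fst : DP k),
      IsStandard b (j - a) fst → Ann fst ∈ GorD j H D →
        (∀ φ : orderGE2 k, Ann (exoticGen b fst φ) ∈ GorD j H D) ∧
        -- the exotic terms of `f`, those of degree `> j - a`, are parametrized by `V`
        (∀ φ ψ : orderGE2 k,
          exoticGen b fst φ - exoticGen b fst ψ ∈ dpLT k (j - a + 1) ↔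
            exoticClass b (j - a) fst φ = exoticClass b (j - a) fst ψ) ∧
        -- the algebra determines its parameter in `V`, through linear equations
        (∀ φ ψ : orderGE2 k,
          (∀ r ∈ IsLocalRing.maximalIdeal (PS k) ^ (j - a),
            r * (dualForm b 2 - coordSeries b ψ) ∈ Ann (exoticGen b fst φ)) ↔
            exoticClass b (j - a) fst ψ = exoticClass b (j - a) fst φ) ∧
        -- the parametrization of the algebras by `V`
        (∀ σ : ExoticSpace b (j - a) fst →ₗ[k] orderGE2 k,
          (∀ v, exoticClass b (j - a) fst (σ v) = v) →
            exoticFamily b (j - a) fst σ ⊆ GorD j H D ∧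
            Set.BijOn (fun v => Ann (exoticGen b fst (σ v))) Set.univ
              (exoticFamily b (j - a) fst σ)) ∧
        Module.Finite k (ExoticSpace b (j - a) fst) ∧
        Module.finrank k (ExoticSpace b (j - a) fst) =
          ∑ c ∈ Finset.range a, ∑ u ∈ Finset.Icc (j - a) (j - c - 2), D c u) := by
  refine ⟨fun f hf => ⟨exists_isAdapted hf hH ha hn hn',
    fun b hb => exists_isStandard_add_exoticPart hb hf⟩, fun b fst hst hG => ?_⟩
  have hann := forall_mul_sub_mem_Ann_iff b hst
  have hmem := fun φ : orderGE2 k => Ann_exoticGen_mem_GorD fst b φ hG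
  refine ⟨hmem, exoticGen_sub_mem_dpLT_iff b hst, hann, fun σ hσ => ⟨?_, ?_, ?_, ?_⟩,
    finite_exoticSpace b hst,
    finrank_exoticSpace b (by omega) (add_two_le_socleDegree hG hH ha hn) hst hG⟩
  · rintro _ ⟨v, rfl⟩
    exact hmem (σ v)
  · exact fun v _ => ⟨v, rfl⟩
  · intro v _ w _ hvw
    have h := (hann (σ v) (σ v)).mpr rfl
    have hvw' : Ann (exoticGen b fst (σ v)) = Ann (exoticGen b fst (σ w)) := hvw
    rw [hvw', hann, hσ, hσ] at h
    exact Subtype.ext h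
  · rintro _ ⟨v, rfl⟩
    exact ⟨v, trivial, rfl⟩
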